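/- Let $A$ be a unital Banach $\mathbb{R}$-algebra with a continuous algebra involution $a\mapsto\bar a$ (a continuous $\mathbb{R}$-algebra homomorphism $A\to A$ with $\bar{\bar a}=a$), and suppose the involution is balanced: there is a unit $u\in A^\times$ with $\bar u=-u$. Let $A_0=\{a\in A:\bar a=a\}$. Let $X$ be a compact Hausdorff space with a continuous involution $x\mapsto\bar x$. An $A$-bundle on $X$ is a locally trivial bundle of left $A$-modules whose fibres are finitely generated projective (carrying their canonical topology as direct summands of some $A^n$), with continuous scalar multiplication. A Real $A$-bundle on $X$ is an $A$-bundle $E$ with a continuous involution $e\mapsto\bar e$ of its total space that maps $E_x$ additively to $E_{\bar x}$ and satisfies $\overline{ae}=\bar a\,\bar e$ for $a\in A$, $e\in E_x$. Isomorphisms of Real $A$-bundles are isomorphisms of $A$-bundles that commute with the involutions. Let $K^A(X)$ and $KR^A(X)$ be the Grothendieck groups, under Whitney sum, of isomorphism classes of $A$-bundles and of Real $A$-bundles on $X$, and let $K_0(R)$ be the Grothendieck group of finitely generated projective left modules over a ring $R$. Then: 1. For every Real $A$-bundle $E$ on $X$ there are $n\ge 0$ and a Real $A$-bundle $F$ on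 $X$ such that $E\oplus F$ is isomorphic, as a Real $A$-bundle, to $X\times A^n$ with the involution $\overline{(x,a)}=(\bar x,\bar a)$. 2. Let $\Lambda$ be the ring, under pointwise operations, of continuous functions $f:X\to A$ with $f(\bar x)=\overline{f(x)}$ for all $x\in X$. For every Real $A$-bundle $E$, the $\Lambda$-module of continuous sections $s$ of $E$ with $s(\bar x)=\overline{s(x)}$ is finitely generated and projective, and sending $[E]$ to the class of this module defines an isomorphism $KR^A(X)\cong K_0(\Lambda)$. 3. If the involution on $X$ is trivial, then for every Real $A$-bundle $E$ the subspace $\{e\in E:\bar e=e\}$ is an $A_0$-bundle on $X$, and sending $[E]$ to the class of this bundle defines an isomorphism $KR^A(X)\cong K^{A_0}(X)$ with the Grothendieck group of $A_0$-bundles on $X$. -/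

import Mathlib

open Bundle Topology

universe u v w

namespace RealK

/-! ## Involutions -/

/-- A space with involution: a continuous self-map of `X` of order two, written `x ↦ τ x`. -/
structure SpaceInvolution (X : Type u) [TopologicalSpace X] where
  toFun : X → X
  continuous' : Continuous toFun
  involutive' : ∀ x, toFun (toFun x) = x

instance {X : Type u} [TopologicalSpace X] : CoeFun (SpaceInvolution X) (fun _ => X → X) :=
  ⟨SpaceInvolution.toFun⟩

/-- A (product-preserving, continuous, real-linear) algebra involution `a ↦ σ a` of a topological
real algebra. -/
structure AlgInvolution (A : Type v) [Ring A] [Algebra ℝ A] [TopologicalSpace A] where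
  toAlgHom : A →ₐ[ℝ] A
  continuous' : Continuous toAlgHom
  involutive' : ∀ a, toAlgHom (toAlgHom a) = a

section Involutions

variable {A : Type v} [Ring A] [Algebra ℝ A] [TopologicalSpace A]

/-- The underlying ring homomorphism of an algebra involution. -/
def AlgInvolution.ringHom (σ : AlgInvolution A) : A →+* A := (σ.toAlgHom : A →+* A)

/-- The involution is balanced: some unit `u` of `A` satisfies `ū = -u`. -/
def AlgInvolution.IsBalanced (σ : AlgInvolution A) : Prop :=
  ∃ a : Aˣ, σ.ringHom (a : A) = -(a : A)

/-- The fixed subalgebra `A₀ = {a | ā = a}`. -/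
def AlgInvolution.fixed (σ : AlgInvolution A) : Subalgebra ℝ A :=
  AlgHom.equalizer σ.toAlgHom (AlgHom.id ℝ A)

end Involutions

/-- The ring `Λ` of continuous functions `f : X → A` with `f (x̄) = \overline{f x}`
(pointwise operations). -/
def equivariantMaps {X : Type u} [TopologicalSpace X] {A : Type v} [Ring A] [Algebra ℝ A]
    [TopologicalSpace A] [IsTopologicalRing A] (σ : AlgInvolution A) (τ : SpaceInvolution X) :
    Subring C(X, A) where
  carrier := {f | ∀ x, f (τ x) = σ.ringHom (f x)}
  mul_mem' hf hg x := by simp [hf x, hg x]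
  one_mem' x := by simp
  add_mem' hf hg x := by simp [hf x, hg x]
  zero_mem' x := by simp
  neg_mem' hf x := by simp [hf x]

/-! ## The monoid of isomorphism classes -/

/-- Isomorphism classes form a commutative monoid under direct sum. -/
@[reducible] def isoClassMonoid {B : Type u} (S : Setoid B) (add : B → B → B) (zero : B)
    (congr : ∀ a a' b b', S.r a a' → S.r b b' → S.r (add a b) (add a' b'))
    (assoc : ∀ a b c, S.r (add (add a b) c) (add a (add b c)))
    (zero_add : ∀ a, S.r (add zero a) a)
    (comm : ∀ a b, S.r (add a b) (add b a)) : AddCommMonoid (Quotient S) :=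
  have hc : ∀ x y : Quotient S,
      Quotient.map₂ add (fun _ _ h _ _ h' => congr _ _ _ _ h h') x y =
        Quotient.map₂ add (fun _ _ h _ _ h' => congr _ _ _ _ h h') y x := by
    rintro ⟨a⟩ ⟨b⟩; exact Quotient.sound (comm a b)
  have hz : ∀ x : Quotient S,
      Quotient.map₂ add (fun _ _ h _ _ h' => congr _ _ _ _ h h') (Quotient.mk S zero) x = x := by
    rintro ⟨a⟩; exact Quotient.sound (zero_add a)
  { add := Quotient.map₂ add (fun _ _ h _ _ h' => congr _ _ _ _ h h')
    zero := Quotient.mk S zero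
    add_assoc := by rintro ⟨a⟩ ⟨b⟩ ⟨c⟩; exact Quotient.sound (assoc a b c)
    zero_add := hz
    add_zero := fun x => (hc _ _).trans (hz x)
    add_comm := hc
    nsmul := @nsmulRec _ ⟨Quotient.mk S zero⟩
      ⟨Quotient.map₂ add (fun _ _ h _ _ h' => congr _ _ _ _ h h')⟩ }

/-! ## `K₀` of a ring -/

/-- A finitely generated projective left `R`-module. -/
structure FGProj (R : Type u) [Ring R] : Type (u + 1) where
  carrier : Type u
  [addCommGroup : AddCommGroup carrier]
  [module : Module R carrier]
  [finite : Module.Finite R carrier]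
  [projective : Module.Projective R carrier]

attribute [instance] FGProj.addCommGroup FGProj.module FGProj.finite FGProj.projective

section FGProj

variable (R : Type u) [Ring R]

/-- Isomorphism of finitely generated projective modules. -/
instance FGProj.setoid : Setoid (FGProj R) where
  r P Q := Nonempty (P.carrier ≃ₗ[R] Q.carrier)
  iseqv := ⟨fun _ => ⟨.refl R _⟩, fun ⟨e⟩ => ⟨e.symm⟩, fun ⟨e⟩ ⟨f⟩ => ⟨e.trans f⟩⟩

/-- Direct sum of finitely generated projective modules. -/
def FGProj.sum (P Q : FGProj R) : FGProj R := ⟨P.carrier × Q.carrier⟩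

instance FGProj.monoid : AddCommMonoid (Quotient (FGProj.setoid R)) :=
  isoClassMonoid (FGProj.setoid R) (FGProj.sum R) ⟨PUnit⟩
    (fun _ _ _ _ ⟨e⟩ ⟨f⟩ => ⟨LinearEquiv.prodCongr e f⟩)
    (fun _ _ _ => ⟨LinearEquiv.prodAssoc R _ _ _⟩)
    (fun _ => ⟨LinearEquiv.uniqueProd⟩)
    (fun _ _ => ⟨LinearEquiv.prodComm R _ _⟩)

/-- `K₀(R)`: the Grothendieck group of finitely generated projective left `R`-modules. -/
abbrev K0 : Type (u + 1) := Algebra.GrothendieckAddGroup (Quotient (FGProj.setoid R))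

variable {R}

/-- The class `[P]` in `K₀(R)`. -/
def K0.mk (P : FGProj R) : K0 R :=
  Algebra.GrothendieckAddGroup.of (Quotient.mk (FGProj.setoid R) P)

end FGProj

/-! ## `A`-bundles -/

/-- An `A`-bundle on `X`: a locally trivial bundle of left `A`-modules with finitely generated
projective fibres. Locally it looks like `U × P`, where `P` is a finitely generated projective
`A`-module with its canonical topology (the topology as a quotient, equivalently as a direct
summand, of some `Aⁿ`; this is the module topology of `P`).
The parameter `A` of `TotalSpace A fiber` is a phantom. -/
structure ABundle (A : Type v) [Ring A] [TopologicalSpace A] (X : Type u) [TopologicalSpace X] :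
    Type (max u (v + 1)) where
  fiber : X → Type v
  [addCommGroup : ∀ x, AddCommGroup (fiber x)]
  [module : ∀ x, Module A (fiber x)]
  [topology : TopologicalSpace (TotalSpace A fiber)]
  continuous_proj : Continuous (fun z : TotalSpace A fiber => z.proj)
  continuous_smul :
    Continuous (fun w : A × TotalSpace A fiber => (⟨w.2.proj, w.1 • w.2.2⟩ : TotalSpace A fiber))
  locallyTrivial : ∀ x₀ : X, ∃ U : Set X, IsOpen U ∧ x₀ ∈ U ∧
    ∃ (P : Type v) (_ : AddCommGroup P) (_ : Module A P) (_ : TopologicalSpace P)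
      (φ : ∀ x : U, fiber x ≃ₗ[A] P),
      IsModuleTopology A P ∧ Module.Finite A P ∧ Module.Projective A P ∧
      Continuous (fun z : {z : TotalSpace A fiber // z.proj ∈ U} => φ ⟨z.1.proj, z.2⟩ z.1.2) ∧
      Continuous (fun y : U × P => (⟨y.1, (φ y.1).symm y.2⟩ : TotalSpace A fiber))

attribute [instance] ABundle.addCommGroup ABundle.module ABundle.topology

namespace ABundle

variable {A : Type v} [Ring A] [TopologicalSpace A] {X : Type u} [TopologicalSpace X]

/-- The total space of an `A`-bundle. -/
abbrev Total (E : ABundle A X) : Type (max u v) := TotalSpace A E.fiber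

/-- The map of total spaces over `X` given by maps of the fibres. -/
def totalMap (E F : ABundle A X) (Φ : ∀ x, E.fiber x → F.fiber x) (z : E.Total) : F.Total :=
  ⟨z.proj, Φ z.proj z.2⟩

/-- Isomorphism of `A`-bundles: fibrewise `A`-linear, bicontinuous on total spaces. -/
def Iso (E F : ABundle A X) : Prop :=
  ∃ Φ : ∀ x, E.fiber x ≃ₗ[A] F.fiber x,
    Continuous (totalMap E F fun x => Φ x) ∧
    Continuous (totalMap F E fun x => (Φ x).symm)

instance setoid : Setoid (ABundle A X) where
  r := Iso
  iseqv :=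
    ⟨fun _ => ⟨fun _ => .refl A _, continuous_id, continuous_id⟩,
     fun ⟨Φ, h, h'⟩ => ⟨fun x => (Φ x).symm, h', h⟩,
     fun ⟨Φ, h, h'⟩ ⟨Ψ, k, k'⟩ => ⟨fun x => (Φ x).trans (Ψ x), k.comp h, h'.comp k'⟩⟩

/-- Topology on the total space of a direct sum: the subspace topology from the product of the
two total spaces. -/
@[reducible] def sumTopology (E F : ABundle A X) :
    TopologicalSpace (TotalSpace A fun x => E.fiber x × F.fiber x) :=
  TopologicalSpace.induced
    (fun z => ((⟨z.proj, z.2.1⟩ : E.Total), (⟨z.proj, z.2.2⟩ : F.Total))) inferInstance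

/-- The Whitney sum. -/
def sum (E F : ABundle A X) : ABundle A X :=
  letI := sumTopology E F
  have h : Continuous fun z : TotalSpace A (fun x => E.fiber x × F.fiber x) =>
    ((⟨z.proj, z.2.1⟩ : E.Total), (⟨z.proj, z.2.2⟩ : F.Total)) := continuous_induced_dom
  { fiber := fun x => E.fiber x × F.fiber x
    topology := sumTopology E F
    continuous_proj := E.continuous_proj.comp h.fst
    continuous_smul := by
      refine continuous_induced_rng.2 ?_
      exact (E.continuous_smul.comp (continuous_fst.prodMk (h.fst.comp continuous_snd))).prodMk
        (F.continuous_smul.comp (continuous_fst.prodMk (h.snd.comp continuous_snd)))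
    locallyTrivial := by
      intro x₀
      obtain ⟨U, hU, hxU, P, _, _, _, φ, hP, hPf, hPp, hφ, hφ'⟩ := E.locallyTrivial x₀
      obtain ⟨V, hV, hxV, Q, _, _, _, ψ, hQ, hQf, hQp, hψ, hψ'⟩ := F.locallyTrivial x₀
      refine ⟨U ∩ V, hU.inter hV, ⟨hxU, hxV⟩, P × Q, inferInstance, inferInstance,
        inferInstance, fun x => LinearEquiv.prodCongr (φ ⟨x.1, x.2.1⟩) (ψ ⟨x.1, x.2.2⟩),
        inferInstance, inferInstance, inferInstance, ?_, ?_⟩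
      · refine Continuous.prodMk ?_ ?_
        · exact hφ.comp ((h.fst.comp continuous_subtype_val).subtype_mk fun z => z.2.1)
        · exact hψ.comp ((h.snd.comp continuous_subtype_val).subtype_mk fun z => z.2.2)
      · refine continuous_induced_rng.2 (Continuous.prodMk ?_ ?_)
        · exact hφ'.comp
            (((continuous_subtype_val.comp continuous_fst).subtype_mk fun y => y.1.2.1).prodMk
              continuous_snd.fst)
        · exact hψ'.comp
            (((continuous_subtype_val.comp continuous_fst).subtype_mk fun y => y.1.2.2).prodMk
              continuous_snd.snd) }

/-- Topology on the total space `X × Aⁿ` of the trivial bundle: the product topology. -/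
@[reducible] def trivialTopology (A : Type v) [TopologicalSpace A] (X : Type u)
    [TopologicalSpace X] (n : ℕ) : TopologicalSpace (TotalSpace A fun _ : X => (Fin n → A)) :=
  TopologicalSpace.induced (fun z => (z.proj, z.2)) (inferInstanceAs (TopologicalSpace (X × (Fin n → A))))

/-- The trivial `A`-bundle `X × Aⁿ`. -/
def trivial (A : Type v) [Ring A] [TopologicalSpace A] [IsTopologicalRing A] (X : Type u)
    [TopologicalSpace X] (n : ℕ) : ABundle A X :=
  letI := trivialTopology A X n
  have h : Continuous fun z : TotalSpace A (fun _ : X => (Fin n → A)) => (z.proj, z.2) :=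
    continuous_induced_dom
  { fiber := fun _ => Fin n → A
    topology := trivialTopology A X n
    continuous_proj := h.fst
    continuous_smul := continuous_induced_rng.2
      ((h.fst.comp continuous_snd).prodMk (continuous_fst.smul (h.snd.comp continuous_snd)))
    locallyTrivial := fun _ => ⟨Set.univ, isOpen_univ, Set.mem_univ _, Fin n → A, inferInstance,
      inferInstance, inferInstance, fun _ => .refl A _, inferInstance, inferInstance,
      inferInstance, h.snd.comp continuous_subtype_val,
      continuous_induced_rng.2
        ((continuous_subtype_val.comp continuous_fst).prodMk continuous_snd)⟩ }

theorem sum_continuous (E F : ABundle A X) :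
    Continuous (totalMap (E.sum F) E fun _ => Prod.fst) ∧
    Continuous (totalMap (E.sum F) F fun _ => Prod.snd) :=
  have h : Continuous fun z : (E.sum F).Total =>
    ((⟨z.proj, z.2.1⟩ : E.Total), (⟨z.proj, z.2.2⟩ : F.Total)) := continuous_induced_dom
  ⟨h.fst, h.snd⟩

theorem continuous_sum {E F : ABundle A X} {Z : Type w} [TopologicalSpace Z]
    {f : Z → (E.sum F).Total}
    (h₁ : Continuous fun z => (⟨(f z).proj, (f z).2.1⟩ : E.Total))
    (h₂ : Continuous fun z => (⟨(f z).proj, (f z).2.2⟩ : F.Total)) : Continuous f :=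
  continuous_induced_rng.2 (h₁.prodMk h₂)

section Monoid

variable (E F G : ABundle A X)

/-- Associativity of the Whitney sum on fibres. -/
def assocFiber (x : X) : ((E.sum F).sum G).fiber x ≃ₗ[A] (E.sum (F.sum G)).fiber x :=
  LinearEquiv.prodAssoc A (E.fiber x) (F.fiber x) (G.fiber x)

theorem assoc_continuous :
    Continuous (totalMap ((E.sum F).sum G) (E.sum (F.sum G)) fun x => assocFiber E F G x) ∧
    Continuous (totalMap (E.sum (F.sum G)) ((E.sum F).sum G) fun x => (assocFiber E F G x).symm) := by
  have h₁ := sum_continuous (E.sum F) G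
  have h₂ := sum_continuous E F
  have h₃ := sum_continuous E (F.sum G)
  have h₄ := sum_continuous F G
  exact ⟨continuous_sum (h₂.1.comp h₁.1) (continuous_sum (h₂.2.comp h₁.1) h₁.2),
    continuous_sum (continuous_sum h₃.1 (h₄.1.comp h₃.2)) (h₄.2.comp h₃.2)⟩

/-- Commutativity of the Whitney sum on fibres. -/
def commFiber (x : X) : (E.sum F).fiber x ≃ₗ[A] (F.sum E).fiber x :=
  LinearEquiv.prodComm A (E.fiber x) (F.fiber x)

theorem comm_continuous :
    Continuous (totalMap (E.sum F) (F.sum E) fun x => commFiber E F x) :=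
  continuous_sum (sum_continuous E F).2 (sum_continuous E F).1

/-- The Whitney sum of fibrewise isomorphisms. -/
def congrFiber {E E' F F' : ABundle A X} (Φ : ∀ x, E.fiber x ≃ₗ[A] E'.fiber x)
    (Ψ : ∀ x, F.fiber x ≃ₗ[A] F'.fiber x) (x : X) : (E.sum F).fiber x ≃ₗ[A] (E'.sum F').fiber x :=
  LinearEquiv.prodCongr (Φ x) (Ψ x)

theorem congr_continuous {E E' F F' : ABundle A X} {Φ : ∀ x, E.fiber x ≃ₗ[A] E'.fiber x}
    {Ψ : ∀ x, F.fiber x ≃ₗ[A] F'.fiber x}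
    (h : Continuous (totalMap E E' fun x => Φ x))
    (k : Continuous (totalMap F F' fun x => Ψ x)) :
    Continuous (totalMap (E.sum F) (E'.sum F') fun x => congrFiber Φ Ψ x) :=
  continuous_sum (h.comp (sum_continuous E F).1) (k.comp (sum_continuous E F).2)

variable [IsTopologicalRing A]

/-- The zero bundle `X × A⁰` is neutral, on fibres. -/
def zeroFiber (x : X) : ((trivial A X 0).sum E).fiber x ≃ₗ[A] E.fiber x :=
  letI : Unique ((trivial A X 0).fiber x) := inferInstanceAs (Unique (Fin 0 → A))
  LinearEquiv.uniqueProd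

theorem zero_continuous :
    Continuous (totalMap ((trivial A X 0).sum E) E fun x => zeroFiber E x) ∧
    Continuous (totalMap E ((trivial A X 0).sum E) fun x => (zeroFiber E x).symm) :=
  ⟨(sum_continuous (trivial A X 0) E).2,
    continuous_sum
      (continuous_induced_rng.2 (E.continuous_proj.prodMk continuous_const)) continuous_id⟩

instance monoid : AddCommMonoid (Quotient (setoid (A := A) (X := X))) :=
  isoClassMonoid setoid sum (trivial A X 0)
    (fun _ _ _ _ ⟨Φ, h, h'⟩ ⟨Ψ, k, k'⟩ => ⟨congrFiber Φ Ψ, congr_continuous h k, congr_continuous h' k'⟩)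
    (fun E F G => ⟨assocFiber E F G, assoc_continuous E F G⟩)
    (fun E => ⟨zeroFiber E, zero_continuous E⟩)
    (fun E F => ⟨commFiber E F, comm_continuous E F, comm_continuous F E⟩)

end Monoid

end ABundle

section KA

variable (A : Type v) [Ring A] [TopologicalSpace A] [IsTopologicalRing A]
  (X : Type u) [TopologicalSpace X]

/-- `K^A(X)`: the Grothendieck group of `A`-bundles on `X`. -/
abbrev KA : Type (max u (v + 1)) :=
  Algebra.GrothendieckAddGroup (Quotient (ABundle.setoid (A := A) (X := X)))

variable {A X}

/-- The class `[E]` in `K^A(X)`. -/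
def KA.mk (E : ABundle A X) : KA A X :=
  Algebra.GrothendieckAddGroup.of (Quotient.mk ABundle.setoid E)

end KA

/-! ## Real `A`-bundles -/

/-- A Real `A`-bundle on `X`: an `A`-bundle with a continuous involution of the total space that
maps `E_x` to `E_{x̄}` additively with `\overline{a e} = ā ē`. -/
structure RealBundle {A : Type v} [Ring A] [Algebra ℝ A] [TopologicalSpace A] {X : Type u}
    [TopologicalSpace X] (σ : AlgInvolution A) (τ : SpaceInvolution X) :
    Type (max u (v + 1)) extends ABundle A X where
  conj : ∀ x, fiber x →ₛₗ[σ.ringHom] fiber (τ x)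
  continuous_conj :
    Continuous (fun z : TotalSpace A fiber => (⟨τ z.proj, conj z.proj z.2⟩ : TotalSpace A fiber))
  conj_conj : ∀ x (e : fiber x),
    (⟨τ (τ x), conj (τ x) (conj x e)⟩ : TotalSpace A fiber) = ⟨x, e⟩

namespace RealBundle

variable {A : Type v} [Ring A] [Algebra ℝ A] [TopologicalSpace A] {X : Type u}
  [TopologicalSpace X] {σ : AlgInvolution A} {τ : SpaceInvolution X}

/-- The involution on the total space. -/
def bar (E : RealBundle σ τ) (z : E.Total) : E.Total := ⟨τ z.proj, E.conj z.proj z.2⟩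

/-- Isomorphism of Real `A`-bundles: an isomorphism of `A`-bundles commuting with the
involutions. -/
def Iso (E F : RealBundle σ τ) : Prop :=
  ∃ Φ : ∀ x, E.fiber x ≃ₗ[A] F.fiber x,
    Continuous (ABundle.totalMap E.toABundle F.toABundle fun x => Φ x) ∧
    Continuous (ABundle.totalMap F.toABundle E.toABundle fun x => (Φ x).symm) ∧
    ∀ x e, Φ (τ x) (E.conj x e) = F.conj x (Φ x e)

instance setoid : Setoid (RealBundle σ τ) where
  r := Iso
  iseqv :=
    ⟨fun _ => ⟨fun _ => .refl A _, continuous_id, continuous_id, fun _ _ => rfl⟩,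
     fun ⟨Φ, h, h', c⟩ => ⟨fun x => (Φ x).symm, h', h, fun x e => by
      rw [LinearEquiv.symm_apply_eq, c, LinearEquiv.apply_symm_apply]⟩,
     fun ⟨Φ, h, h', c⟩ ⟨Ψ, k, k', d⟩ => ⟨fun x => (Φ x).trans (Ψ x), k.comp h, h'.comp k',
      fun x e => by simp [c, d]⟩⟩

/-- The Whitney sum of Real `A`-bundles, with the involution acting on both summands. -/
@[reducible] def sum (E F : RealBundle σ τ) : RealBundle σ τ where
  toABundle := E.toABundle.sum F.toABundle
  conj x :=
    { toFun := fun e => (E.conj x e.1, F.conj x e.2)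
      map_add' := fun e f =>
        Prod.ext ((E.conj x).map_add e.1 f.1) ((F.conj x).map_add e.2 f.2)
      map_smul' := fun a e =>
        Prod.ext ((E.conj x).map_smulₛₗ a e.1) ((F.conj x).map_smulₛₗ a e.2) }
  continuous_conj := ABundle.continuous_sum
    (E.continuous_conj.comp (ABundle.sum_continuous E.toABundle F.toABundle).1)
    (F.continuous_conj.comp (ABundle.sum_continuous E.toABundle F.toABundle).2)
  conj_conj x e := by
    have key : ∀ (y : X) (a : E.fiber y) (b : F.fiber y) (a' : E.fiber x) (b' : F.fiber x),
        (⟨y, a⟩ : E.Total) = ⟨x, a'⟩ → (⟨y, b⟩ : F.Total) = ⟨x, b'⟩ →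
        (⟨y, (a, b)⟩ : (E.toABundle.sum F.toABundle).Total) = ⟨x, (a', b')⟩ := by
      intro y a b a' b' h k
      obtain rfl : y = x := congrArg TotalSpace.proj h
      cases h
      cases k
      rfl
    exact key _ _ _ _ _ (E.conj_conj x e.1) (F.conj_conj x e.2)

variable [IsTopologicalRing A]

/-- The trivial Real `A`-bundle `X × Aⁿ` with involution `(x, a) ↦ (x̄, ā)`. -/
@[reducible] def trivial (σ : AlgInvolution A) (τ : SpaceInvolution X) (n : ℕ) : RealBundle σ τ where
  toABundle := ABundle.trivial A X n
  conj x :=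
    { toFun := fun (e : Fin n → A) i => σ.ringHom (e i)
      map_add' := fun e f => funext fun i => map_add σ.ringHom (e i) (f i)
      map_smul' := fun a e => funext fun i => map_mul σ.ringHom a (e i) }
  continuous_conj := by
    have h : Continuous fun z : (ABundle.trivial A X n).Total =>
      ((z.proj, z.2) : X × (Fin n → A)) := continuous_induced_dom
    exact continuous_induced_rng.2 ((τ.continuous'.comp h.fst).prodMk
      (continuous_pi fun i => σ.continuous'.comp ((continuous_apply i).comp h.snd)))
  conj_conj x e := by
    have key : ∀ (y : X) (a b : Fin n → A), y = x → a = b →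
        (⟨y, a⟩ : (ABundle.trivial A X n).Total) = ⟨x, b⟩ := by
      rintro y a b rfl rfl; rfl
    exact key _ _ _ (τ.involutive' x) (funext fun i => σ.involutive' _)

instance monoid : AddCommMonoid (Quotient (setoid (σ := σ) (τ := τ))) :=
  isoClassMonoid setoid sum (trivial σ τ 0)
    (fun _ _ _ _ ⟨Φ, h, h', c⟩ ⟨Ψ, k, k', d⟩ =>
      ⟨ABundle.congrFiber Φ Ψ, ABundle.congr_continuous h k, ABundle.congr_continuous h' k',
        fun x e => Prod.ext (c x e.1) (d x e.2)⟩)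
    (fun E F G => ⟨ABundle.assocFiber E.toABundle F.toABundle G.toABundle,
      (ABundle.assoc_continuous E.toABundle F.toABundle G.toABundle).1,
      (ABundle.assoc_continuous E.toABundle F.toABundle G.toABundle).2, fun _ _ => rfl⟩)
    (fun E => ⟨ABundle.zeroFiber E.toABundle, (ABundle.zero_continuous E.toABundle).1,
      (ABundle.zero_continuous E.toABundle).2, fun _ _ => rfl⟩)
    (fun E F => ⟨ABundle.commFiber E.toABundle F.toABundle,
      ABundle.comm_continuous E.toABundle F.toABundle,
      ABundle.comm_continuous F.toABundle E.toABundle, fun _ _ => rfl⟩)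

end RealBundle

section KR

variable {A : Type v} [Ring A] [Algebra ℝ A] [TopologicalSpace A] [IsTopologicalRing A]
  {X : Type u} [TopologicalSpace X] (σ : AlgInvolution A) (τ : SpaceInvolution X)

/-- `KR^A(X)`: the Grothendieck group of Real `A`-bundles on `X`. -/
abbrev KR : Type (max u (v + 1)) :=
  Algebra.GrothendieckAddGroup (Quotient (RealBundle.setoid (σ := σ) (τ := τ)))

variable {σ τ}

/-- The class `[E]` in `KR^A(X)`. -/
def KR.mk (E : RealBundle σ τ) : KR σ τ :=
  Algebra.GrothendieckAddGroup.of (Quotient.mk RealBundle.setoid E)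

/-- The `Λ`-module `P` is isomorphic to the module of continuous sections `s` of `E` with
`s (x̄) = \overline{s x}`, on which `Λ` acts pointwise: `j` is a `Λ`-linear bijection from `P` onto
these sections. -/
def IsRealSections (P : FGProj (equivariantMaps σ τ)) (E : RealBundle σ τ) : Prop :=
  ∃ j : P.carrier →+ (∀ x, E.fiber x),
    Function.Injective j ∧
    (∀ (f : equivariantMaps σ τ) (p : P.carrier) (x : X),
      j (f • p) x = (f : C(X, A)) x • j p x) ∧
    Set.range j = {s | Continuous (fun x => (⟨x, s x⟩ : E.Total)) ∧
      ∀ x, s (τ x) = E.conj x (s x)}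

/-- The `A₀`-bundle `F` is isomorphic to the bundle of fixed points of the involution of `E` (for
trivial involution on `X`): `j` is a fibrewise `A₀`-linear homeomorphism from `F` onto the
subspace `{z | z̄ = z}` of the total space of `E`. -/
def IsFixedBundle (F : ABundle σ.fixed X) (E : RealBundle σ τ) : Prop :=
  ∃ j : ∀ x, F.fiber x →+ E.fiber x,
    (∀ (a : σ.fixed) (x : X) (e : F.fiber x), j x (a • e) = (a : A) • j x e) ∧
    IsEmbedding (fun z : F.Total => (⟨z.proj, j z.proj z.2⟩ : E.Total)) ∧
    Set.range (fun z : F.Total => (⟨z.proj, j z.proj z.2⟩ : E.Total)) = {z | E.bar z = z}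

end KR

end RealK

/-! Everything rests on frames: finitely many continuous sections `s_i` of a bundle together with
continuous `A`-linear coordinates `c_i` such that `e = ∑ c_i(e) s_i`. A frame makes the bundle a
direct summand of `X × Aⁿ`, the image of the matrix-valued function `p(x)_ij = c_j(s_i(x))`. This
`p` is idempotent and acts on row vectors from the right, since the modules are left modules. Over a
compact Hausdorff base a partition of unity glues local presentations of the fibres into a frame
(`ABundle.exists_frame`). Conversely, the row spaces of a continuous family of idempotents form a
bundle (`ABundle.ofIdem`): nearby idempotents are conjugate by an explicit matrix that is the
identity at the base point, and invertibility is an open condition over a complete ring.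

Balancedness makes frames equivariant. Adjoining to a frame its conjugate gives a family on which
the involution swaps the two halves. The sums `s + s̄` are invariant and the differences `s - s̄`
change sign; multiplying a difference by `u⁻¹`, which also changes sign, makes it invariant
(`RealBundle.exists_isReal_of_frame`). The resulting idempotent satisfies `p(x̄) = \overline{p(x)}`,
so `1 - p` defines a Real complement, which is statement 1.

For statement 2, an equivariant frame of `E` expresses its module of equivariant sections as a
summand of `Λⁿ`. A `Λ`-linear map between section modules extends to a bundle map through the frame,
so isomorphic section modules come from isomorphic bundles. An idempotent endomorphism of `Λⁿ` is an
equivariant family of idempotent matrices, so every finitely generated projective module occurs.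

For statement 3, when the involution on `X` is trivial, the equivariant idempotent has entries in
`A₀`: read over `A₀` it presents the fixed bundle, and an idempotent over `A₀` read over `A`
presents a Real bundle. No tensor product is needed to show that the fixed bundle determines `E`:
equivariant sections of `E` are the sections of its fixed bundle, and these determine `E` by the
argument for statement 2. -/

namespace RealK

/-! ## Isomorphisms of Grothendieck groups -/

/-- A relation between two classes of objects that is total on both sides, respects sums and
matches the two notions of isomorphism induces an isomorphism of Grothendieck groups. -/
theorem exists_addEquiv_of_rel {B : Type u} {C : Type v} (S : Setoid B) (T : Setoid C)
    [AddCommMonoid (Quotient S)] [AddCommMonoid (Quotient T)] (addB : B → B → B)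
    (addC : C → C → C)
    (hB : ∀ b b', (Quotient.mk S b + Quotient.mk S b') = Quotient.mk S (addB b b'))
    (hC : ∀ c c', (Quotient.mk T c + Quotient.mk T c') = Quotient.mk T (addC c c'))
    (Rel : B → C → Prop) (left : ∀ b, ∃ c, Rel b c) (right : ∀ c, ∃ b, Rel b c)
    (iso : ∀ {b b' c c'}, Rel b c → Rel b' c' → (S.r b b' ↔ T.r c c'))
    (sum : ∀ {b b' c c'}, Rel b c → Rel b' c' → Rel (addB b b') (addC c c')) :
    ∃ φ : Algebra.GrothendieckAddGroup (Quotient S) ≃+ Algebra.GrothendieckAddGroup (Quotient T),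
      ∀ b, ∃ c, Rel b c ∧ φ (Algebra.GrothendieckAddGroup.of (Quotient.mk S b)) =
        Algebra.GrothendieckAddGroup.of (Quotient.mk T c) := by
  choose l hl using left
  choose r hr using right
  -- The relation need not be a function, but `iso` makes any two choices of partner isomorphic, so
  -- `l` and `r` descend to mutually inverse maps of classes.
  let e : Quotient S ≃+ Quotient T :=
    { toFun := Quotient.map l fun b b' h => (iso (hl b) (hl b')).1 h
      invFun := Quotient.map r fun c c' h => (iso (hr c) (hr c')).2 h
      left_inv := by
        rintro ⟨b⟩
        exact Quotient.sound ((iso (hr (l b)) (hl b)).2 (T.refl _))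
      right_inv := by
        rintro ⟨c⟩
        exact Quotient.sound ((iso (hl (r c)) (hr c)).1 (S.refl _))
      map_add' := by
        rintro ⟨b⟩ ⟨b'⟩
        refine (congrArg (Quotient.map l _) (hB b b')).trans (Eq.trans ?_ (hC (l b) (l b')).symm)
        exact Quotient.sound ((iso (hl _) (sum (hl b) (hl b'))).1 (S.refl _)) }
  let f := Algebra.GrothendieckAddGroup.lift (Algebra.GrothendieckAddGroup.of.comp e.toAddMonoidHom)
  let g := Algebra.GrothendieckAddGroup.lift
    (Algebra.GrothendieckAddGroup.of.comp e.symm.toAddMonoidHom)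
  have hf : ∀ x, f (Algebra.GrothendieckAddGroup.of x) = Algebra.GrothendieckAddGroup.of (e x) :=
    fun x => DFunLike.congr_fun (Algebra.GrothendieckAddGroup.lift.symm_apply_apply
      (Algebra.GrothendieckAddGroup.of.comp e.toAddMonoidHom)) x
  have hg : ∀ x, g (Algebra.GrothendieckAddGroup.of x) =
      Algebra.GrothendieckAddGroup.of (e.symm x) :=
    fun x => DFunLike.congr_fun (Algebra.GrothendieckAddGroup.lift.symm_apply_apply
      (Algebra.GrothendieckAddGroup.of.comp e.symm.toAddMonoidHom)) x
  have hgf : g.comp f = AddMonoidHom.id _ := by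
    refine Algebra.GrothendieckAddGroup.lift.symm.injective ?_
    ext x
    change g (f (Algebra.GrothendieckAddGroup.of x)) = Algebra.GrothendieckAddGroup.of x
    rw [hf, hg, e.symm_apply_apply]
  have hfg : f.comp g = AddMonoidHom.id _ := by
    refine Algebra.GrothendieckAddGroup.lift.symm.injective ?_
    ext x
    change f (g (Algebra.GrothendieckAddGroup.of x)) = Algebra.GrothendieckAddGroup.of x
    rw [hg, hf, e.apply_symm_apply]
  exact ⟨f.toAddEquiv g hgf hfg, fun b => ⟨l b, hl b, hf _⟩⟩

/-! ## Continuity of fibrewise operations -/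

theorem continuous_of_local {Z : Type u} {Y : Type v} [TopologicalSpace Z] [TopologicalSpace Y]
    {F : Z → Y} (h : ∀ z₀, ∃ V : Set Z, IsOpen V ∧ z₀ ∈ V ∧ Continuous fun z : V => F z) :
    Continuous F := by
  refine continuous_iff_continuousAt.2 fun z₀ => ?_
  obtain ⟨V, hV, hz, hF⟩ := h z₀
  exact (continuousOn_iff_continuous_domRestrict.2 hF).continuousAt (hV.mem_nhds hz)

/-- Gluing a map defined near a closed set with a map defined away from it. -/
theorem continuous_glue {Z : Type u} {Y : Type v} [TopologicalSpace Z] [TopologicalSpace Y]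
    {F G : Z → Y} {U K : Set Z} (hU : IsOpen U) (hK : IsClosed K) (hKU : K ⊆ U)
    (hF : Continuous fun z : U => F z) (hG : Continuous G) (h : ∀ z, z ∉ K → F z = G z) :
    Continuous F := by
  refine continuous_of_local fun z₀ => ?_
  by_cases hz : z₀ ∈ U
  · exact ⟨U, hU, hz, hF⟩
  · refine ⟨Kᶜ, hK.isOpen_compl, fun hk => hz (hKU hk), ?_⟩
    have : (fun z : ↥(Kᶜ) => F z) = fun z : ↥(Kᶜ) => G z := funext fun z => h z.1 z.2
    rw [this]
    exact hG.comp continuous_subtype_val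

namespace ABundle

variable {A : Type v} [Ring A] [TopologicalSpace A] {X : Type u} [TopologicalSpace X]
  (E : ABundle A X) {Z : Type w} [TopologicalSpace Z] {b : Z → X}

theorem base_continuous {f : ∀ z, E.fiber (b z)}
    (hf : Continuous fun z => (⟨b z, f z⟩ : E.Total)) : Continuous b :=
  E.continuous_proj.comp hf

theorem continuous_smul_section {a : Z → A} {f : ∀ z, E.fiber (b z)} (ha : Continuous a)
    (hf : Continuous fun z => (⟨b z, f z⟩ : E.Total)) :
    Continuous fun z => (⟨b z, a z • f z⟩ : E.Total) :=
  E.continuous_smul.comp (ha.prodMk hf)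

theorem continuous_zero_section (hb : Continuous b) :
    Continuous fun z => (⟨b z, 0⟩ : E.Total) := by
  refine continuous_of_local fun z₀ => ?_
  obtain ⟨U, hU, hz, P, _, _, _, φ, hP, -, -, -, hφ'⟩ := E.locallyTrivial (b z₀)
  refine ⟨b ⁻¹' U, hU.preimage hb, hz, ?_⟩
  have hb' : Continuous fun z : b ⁻¹' U => (⟨b z, z.2⟩ : U) :=
    (hb.comp continuous_subtype_val).subtype_mk _
  refine (hφ'.comp (hb'.prodMk (continuous_const (y := (0 : P))))).congr fun z => ?_
  simp

/-- The bundle axioms assert continuity of scalar multiplication only. Addition is continuous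
because it is so in a chart, where the model fibre has the module topology. -/
theorem continuous_add_section [IsTopologicalRing A] {f g : ∀ z, E.fiber (b z)}
    (hf : Continuous fun z => (⟨b z, f z⟩ : E.Total))
    (hg : Continuous fun z => (⟨b z, g z⟩ : E.Total)) :
    Continuous fun z => (⟨b z, f z + g z⟩ : E.Total) := by
  have hb := E.base_continuous hf
  refine continuous_of_local fun z₀ => ?_
  obtain ⟨U, hU, hz, P, _, _, _, φ, hP, -, -, hφ, hφ'⟩ := E.locallyTrivial (b z₀)
  have : ContinuousAdd P := IsModuleTopology.toContinuousAdd A P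
  refine ⟨b ⁻¹' U, hU.preimage hb, hz, ?_⟩
  have hb' : Continuous fun z : b ⁻¹' U => (⟨b z, z.2⟩ : U) :=
    (hb.comp continuous_subtype_val).subtype_mk _
  have hf' : Continuous fun z : b ⁻¹' U => φ ⟨b z, z.2⟩ (f z) :=
    hφ.comp ((hf.comp continuous_subtype_val).subtype_mk fun z => z.2)
  have hg' : Continuous fun z : b ⁻¹' U => φ ⟨b z, z.2⟩ (g z) :=
    hφ.comp ((hg.comp continuous_subtype_val).subtype_mk fun z => z.2)
  refine (hφ'.comp (hb'.prodMk (hf'.add hg'))).congr fun z => ?_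
  simp

theorem continuous_sum_section [IsTopologicalRing A] {ι : Type*} (t : Finset ι)
    {f : ι → ∀ z, E.fiber (b z)} (hb : Continuous b)
    (hf : ∀ i, Continuous fun z => (⟨b z, f i z⟩ : E.Total)) :
    Continuous fun z => (⟨b z, ∑ i ∈ t, f i z⟩ : E.Total) := by
  classical
  induction t using Finset.induction_on with
  | empty => simpa using E.continuous_zero_section hb
  | insert i t hi ih =>
    refine (E.continuous_add_section (hf i) ih).congr fun z => ?_
    rw [Finset.sum_insert hi]

theorem continuous_neg_section {f : ∀ z, E.fiber (b z)}
    (hf : Continuous fun z => (⟨b z, f z⟩ : E.Total)) :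
    Continuous fun z => (⟨b z, -f z⟩ : E.Total) := by
  refine (E.continuous_smul_section (a := fun _ => -1) continuous_const hf).congr fun z => ?_
  simp

/-! ## Frames -/

/-- A finite family of continuous sections of `E` with continuous coordinate functions: a
presentation of `E` as a direct summand of a trivial bundle. -/
structure Frame (E : ABundle A X) (ι : Type w) [Fintype ι] where
  sec : ι → ∀ x, E.fiber x
  coord : ∀ x, E.fiber x →ₗ[A] (ι → A)
  continuous_sec : ∀ i, Continuous fun x => (⟨x, sec i x⟩ : E.Total)
  continuous_coord : Continuous fun z : E.Total => coord z.proj z.2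
  sum_coord : ∀ x e, ∑ i, coord x e i • sec i x = e

variable {E}

/-- Change of the index set of a frame. -/
def Frame.reindex {ι : Type w} {κ : Type*} [Fintype ι] [Fintype κ] (S : E.Frame ι) (f : κ ≃ ι) :
    E.Frame κ where
  sec k := S.sec (f k)
  coord x := (LinearMap.funLeft A A f).comp (S.coord x)
  continuous_sec k := S.continuous_sec (f k)
  continuous_coord :=
    continuous_pi fun k => (continuous_apply (f k)).comp S.continuous_coord
  sum_coord x e := (f.sum_comp fun i => S.coord x e i • S.sec i x).trans (S.sum_coord x e)

theorem Frame.continuous_combination [IsTopologicalRing A] {ι : Type*} [Fintype ι]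
    {a : ι → Z → A} (hb : Continuous b) (ha : ∀ i, Continuous (a i)) {s : ι → ∀ x, E.fiber x}
    (hs : ∀ i, Continuous fun x => (⟨x, s i x⟩ : E.Total)) :
    Continuous fun z => (⟨b z, ∑ i, a i z • s i (b z)⟩ : E.Total) :=
  E.continuous_sum_section _ hb fun i => E.continuous_smul_section (ha i) ((hs i).comp hb)

/-- Over a compact Hausdorff space every bundle has a finite frame. -/
theorem exists_frame [IsTopologicalRing A] [Algebra ℝ A] [ContinuousSMul ℝ A] [CompactSpace X]
    [T2Space X] (E : ABundle A X) : ∃ n, Nonempty (E.Frame (Fin n)) := by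
  classical
  choose U hU hxU P i₁ i₂ i₃ φ hP hPf hPp hφ hφ' using E.locallyTrivial
  obtain ⟨t, ht⟩ := isCompact_univ.elim_finite_subcover U hU
    fun x _ => Set.mem_iUnion.2 ⟨x, hxU x⟩
  obtain ⟨ρ, hρ⟩ := PartitionOfUnity.exists_isSubordinate isClosed_univ (fun x : t => U x)
    (fun x => hU x) (fun x hx => by
      obtain ⟨y, hy, hxy⟩ := Set.mem_iUnion₂.1 (ht hx)
      exact Set.mem_iUnion.2 ⟨⟨y, hy⟩, hxy⟩)
  -- Each model fibre is a retract of a free module: `r` maps `Aⁿ` onto it and `i` is a section of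
  -- `r`.
  choose n r i _ _ hri using fun x : X => Module.Finite.exists_comp_eq_id_of_projective A (P x)
  have hi : ∀ x, Continuous (i x) := fun x => IsModuleTopology.continuous_of_linearMap (i x)
  -- Sections and coordinates must both be cut off to extend by zero beyond the chart. Giving each
  -- the weight `√ρ` makes their product carry `ρ`, and the weights sum to one. Being real scalars,
  -- the weights are central, so the coordinates stay `A`-linear.
  let w (k : t) (x : X) : A := algebraMap ℝ A (√(ρ k x))
  have hw : ∀ k, Continuous (w k) := fun k =>
    (continuous_algebraMap ℝ A).comp (Real.continuous_sqrt.comp (ρ k).continuous)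
  have hw0 : ∀ k x, x ∉ tsupport (ρ k) → w k x = 0 := fun k x hx => by
    simp [w, image_eq_zero_of_notMem_tsupport hx]
  have hww : ∀ x, ∑ k, w k x * w k x = 1 := fun x => by
    have h1 : ∑ k, ρ k x = 1 := by
      rw [← finsum_eq_sum_of_fintype]; exact ρ.sum_eq_one (Set.mem_univ x)
    have : ∀ k, w k x * w k x = algebraMap ℝ A (ρ k x) := fun k => by
      rw [← map_mul, Real.mul_self_sqrt (ρ.nonneg k x)]
    simp_rw [this, ← map_sum, h1, map_one]
  have hcomm : ∀ k x (a : A), a * w k x = w k x * a := fun k x a =>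
    (Algebra.commutes (√(ρ k x)) a).symm
  let S : E.Frame (Σ k : t, Fin (n k)) :=
    -- The value `0` off the chart is consistent: the weight already vanishes off the support of
    -- `ρ`, a closed set inside the chart.
    { sec := fun m x => if h : x ∈ U m.1 then
        w m.1 x • (φ m.1 ⟨x, h⟩).symm (r m.1 (Pi.single m.2 1)) else 0
      coord := fun x =>
        { toFun := fun e m => if h : x ∈ U m.1 then
            w m.1 x * i m.1 (φ m.1 ⟨x, h⟩ e) m.2 else 0
          map_add' := fun e f => by
            ext m
            by_cases h : x ∈ U m.1 <;> simp [h, mul_add]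
          map_smul' := fun a e => by
            ext m
            by_cases h : x ∈ U m.1 <;> simp [h, ← mul_assoc, hcomm] }
      continuous_sec := fun m => by
        refine continuous_glue (hU m.1) (isClosed_tsupport (ρ m.1)) (hρ m.1) ?_
          (E.continuous_zero_section continuous_id) fun x hx => ?_
        · refine (E.continuous_smul_section ((hw m.1).comp continuous_subtype_val)
            ((hφ' m.1).comp (continuous_id.prodMk (continuous_const
              (y := r m.1 (Pi.single m.2 1)))))).congr fun x => ?_
          simp
        · simp [hw0 m.1 x hx]
      continuous_coord := by
        refine continuous_pi fun m => ?_
        refine continuous_glue ((hU m.1).preimage E.continuous_proj)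
          ((isClosed_tsupport (ρ m.1)).preimage E.continuous_proj)
          (Set.preimage_mono (hρ m.1)) ?_ (continuous_const (y := (0 : A))) fun z hz => ?_
        · refine (((hw m.1).comp (E.continuous_proj.comp continuous_subtype_val)).mul
            ((continuous_apply m.2).comp ((hi m.1).comp (hφ m.1)))).congr fun z => ?_
          have : z.1.proj ∈ U m.1 := z.2
          simp [this]
        · simp [hw0 m.1 z.proj hz]
      sum_coord := fun x e => by
        rw [Fintype.sum_sigma]
        have key : ∀ k : t, ∑ l, (if h : x ∈ U k then w k x * i k (φ k ⟨x, h⟩ e) l else 0) •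
            (if h : x ∈ U k then w k x • (φ k ⟨x, h⟩).symm (r k (Pi.single l 1)) else 0) =
            (w k x * w k x) • e := fun k => by
          by_cases h : x ∈ U k
          · simp only [h, dite_true]
            have h1 : ∀ l, (w k x * i k (φ k ⟨x, h⟩ e) l) •
                w k x • (φ k ⟨x, h⟩).symm (r k (Pi.single l 1)) = (w k x * w k x) •
                (φ k ⟨x, h⟩).symm (r k (i k (φ k ⟨x, h⟩ e) l • Pi.single l 1)) := fun l => by
              rw [map_smul, map_smul, smul_smul, smul_smul, mul_assoc, hcomm, mul_assoc]
            simp_rw [h1]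
            rw [← Finset.smul_sum, ← map_sum, ← map_sum, ← pi_eq_sum_univ']
            have := LinearMap.congr_fun (hri k) (φ k ⟨x, h⟩ e)
            simp only [LinearMap.comp_apply, LinearMap.id_apply] at this
            rw [this, LinearEquiv.symm_apply_apply]
          · have : w k x = 0 := hw0 k x fun h' => h (hρ k h')
            simp [h, this]
        refine (Finset.sum_congr rfl fun k _ => key k).trans ?_
        rw [← Finset.sum_smul, hww, one_smul] }
  exact ⟨_, ⟨S.reindex (Fintype.equivFin _).symm⟩⟩

end ABundle

open scoped Matrix

/-! ## The bundle of an idempotent matrix of functions -/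

section FixedVectors

variable {A : Type v} [Ring A] {ι : Type} [Fintype ι]

/-- The left submodule of row vectors fixed by right multiplication by a matrix. For an
idempotent matrix this is its row space. -/
def fixedVectors (M : Matrix ι ι A) : Submodule A (ι → A) where
  carrier := {v | v ᵥ* M = v}
  add_mem' {v w} hv hw := by
    simp only [Set.mem_ofPred_eq] at *
    rw [Matrix.add_vecMul, hv, hw]
  zero_mem' := Matrix.zero_vecMul M
  smul_mem' a v hv := by
    simp only [Set.mem_ofPred_eq] at *
    rw [Matrix.smul_vecMul, hv]

theorem mem_fixedVectors {M : Matrix ι ι A} {v : ι → A} : v ∈ fixedVectors M ↔ v ᵥ* M = v :=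
  Iff.rfl

theorem vecMul_mem_fixedVectors {M N : Matrix ι ι A} (h : N * M = N) (v : ι → A) :
    v ᵥ* N ∈ fixedVectors M := by
  rw [mem_fixedVectors, Matrix.vecMul_vecMul, h]

/-- The projection onto the row space of an idempotent matrix. -/
def fixedProjection {M : Matrix ι ι A} (h : M * M = M) : (ι → A) →ₗ[A] fixedVectors M :=
  LinearMap.codRestrict _ (Matrix.vecMulLinear M) (vecMul_mem_fixedVectors h)

theorem fixedProjection_comp_subtype {M : Matrix ι ι A} (h : M * M = M) :
    (fixedProjection h).comp (fixedVectors M).subtype = LinearMap.id := by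
  ext v : 2
  exact v.2

theorem finite_fixedVectors {M : Matrix ι ι A} (h : M * M = M) :
    Module.Finite A (fixedVectors M) :=
  Module.Finite.of_surjective (fixedProjection h) fun v =>
    ⟨v, LinearMap.congr_fun (fixedProjection_comp_subtype h) v⟩

theorem projective_fixedVectors {M : Matrix ι ι A} (h : M * M = M) :
    Module.Projective A (fixedVectors M) :=
  Module.Projective.of_split (fixedVectors M).subtype (fixedProjection h)
    (fixedProjection_comp_subtype h)

end FixedVectors

/-! ### Invertible matrices over a complete normed ring -/

section Matrix

variable {A : Type v} [NormedRing A] [CompleteSpace A] {ι : Type} [Fintype ι] [DecidableEq ι]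

/-- Both facts hold in any complete normed ring. Matrices carry the product topology; the `ℓ∞`
operator norm induces the same uniformity, so it can be introduced locally and completeness carries
over. -/
theorem isOpen_isUnit_matrix_and_continuousAt_inverse :
    IsOpen {M : Matrix ι ι A | IsUnit M} ∧
      ∀ M : (Matrix ι ι A)ˣ, ContinuousAt Ring.inverse (M : Matrix ι ι A) := by
  have hA : CompleteSpace (Matrix ι ι A) := inferInstance
  let r : NormedRing (Matrix ι ι A) := Matrix.linftyOpNormedRing
  have : @CompleteSpace (Matrix ι ι A) r.toMetricSpace.toPseudoMetricSpace.toUniformSpace := hA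
  exact ⟨Units.isOpen, NormedRing.inverse_continuousAt⟩

end Matrix

namespace ABundle

variable {A : Type v} [NormedRing A] [CompleteSpace A] {X : Type u} [TopologicalSpace X]
  {ι : Type} [Fintype ι]

/-- The subspace topology on the family of row spaces of a family of matrices. -/
@[reducible] def idemTopology (q : X → Matrix ι ι A) :
    TopologicalSpace (TotalSpace A fun x => fixedVectors (q x)) :=
  TopologicalSpace.induced (fun z => ((z.proj, z.2) : X × (ι → A))) inferInstance

/-- The bundle of row spaces of a continuous family of idempotent matrices. -/
def ofIdem (q : X → Matrix ι ι A) (hq : Continuous q) (h : ∀ x, q x * q x = q x) :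
    ABundle A X :=
  letI := idemTopology q
  have hc : Continuous fun z : TotalSpace A (fun x => fixedVectors (q x)) =>
    ((z.proj, z.2) : X × (ι → A)) := continuous_induced_dom
  { fiber := fun x => fixedVectors (q x)
    topology := idemTopology q
    continuous_proj := hc.fst
    continuous_smul := continuous_induced_rng.2
      ((hc.fst.comp continuous_snd).prodMk (continuous_fst.smul (hc.snd.comp continuous_snd)))
    locallyTrivial := by
      classical
      intro x₀
      -- The standard intertwiner of two idempotents: `q(x) W = W q(x₀)` and `W(x₀) = 1`. Where it
      -- is invertible, right multiplication by it carries the row space of `q(x)` isomorphically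
      -- onto that of `q(x₀)`.
      let W (x : X) : Matrix ι ι A := q x * q x₀ + (1 - q x) * (1 - q x₀)
      have hW : Continuous W := by fun_prop
      have hW₀ : W x₀ = 1 := by
        simp only [W, mul_sub, sub_mul, h, one_mul, mul_one]
        abel
      have hl : ∀ x, q x * W x = W x * q x₀ := fun x => by
        simp only [W, mul_add, add_mul, mul_sub, sub_mul, ← mul_assoc, h, one_mul, mul_one]
        simp only [mul_assoc, h]
        abel
      obtain ⟨ho, hi⟩ := isOpen_isUnit_matrix_and_continuousAt_inverse (A := A) (ι := ι)
      let U : Set X := {x | IsUnit (W x)}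
      have hV : ∀ x : U, W x * Ring.inverse (W x) = 1 := fun x => Ring.mul_inverse_cancel _ x.2
      have hV' : ∀ x : U, Ring.inverse (W x) * W x = 1 := fun x => Ring.inverse_mul_cancel _ x.2
      have hr : ∀ x : U, q x₀ * Ring.inverse (W x) = Ring.inverse (W x) * q x := fun x => by
        calc q x₀ * Ring.inverse (W x)
            = Ring.inverse (W x) * (W x * q x₀) * Ring.inverse (W x) := by
              rw [← mul_assoc, hV', one_mul]
          _ = Ring.inverse (W x) * q x := by
              rw [← hl, mul_assoc, mul_assoc, hV, mul_one]
      have hVc : Continuous fun x : U => Ring.inverse (W x) :=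
        continuous_iff_continuousAt.2 fun x => by
          obtain ⟨M, hM⟩ : IsUnit (W x) := x.2
          exact ContinuousAt.comp (f := fun x : U => W x) (by rw [← hM]; exact hi M)
            (hW.comp continuous_subtype_val).continuousAt
      -- The model fibre gets the module topology by decree. It meets the subspace topology of the
      -- total space through the inclusion into `Aⁿ` and the projection from it, both continuous
      -- because they are linear.
      let _ : TopologicalSpace (fixedVectors (q x₀)) := moduleTopology A (fixedVectors (q x₀))
      have hm : IsModuleTopology A (fixedVectors (q x₀)) := ⟨rfl⟩
      have := IsModuleTopology.toContinuousAdd A (fixedVectors (q x₀))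
      have := IsModuleTopology.toContinuousSMul A (fixedVectors (q x₀))
      have hsub := IsModuleTopology.continuous_of_linearMap (fixedVectors (q x₀)).subtype
      have hproj := IsModuleTopology.continuous_of_linearMap (fixedProjection (h x₀))
      refine ⟨U, ho.preimage hW, by simp [U, hW₀], fixedVectors (q x₀), inferInstance,
        inferInstance, inferInstance, fun x =>
        { toFun := fun v => ⟨v.1 ᵥ* W x, by
            rw [mem_fixedVectors, Matrix.vecMul_vecMul, ← hl, ← Matrix.vecMul_vecMul, v.2]⟩
          invFun := fun v => ⟨v.1 ᵥ* Ring.inverse (W x), by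
            rw [mem_fixedVectors, Matrix.vecMul_vecMul, ← hr, ← Matrix.vecMul_vecMul, v.2]⟩
          map_add' := fun v w => Subtype.ext (Matrix.add_vecMul _ _ _)
          map_smul' := fun a v => Subtype.ext (Matrix.smul_vecMul _ _ _)
          left_inv := fun v => Subtype.ext (by
            simp only [Matrix.vecMul_vecMul, hV, Matrix.vecMul_one])
          right_inv := fun v => Subtype.ext (by
            simp only [Matrix.vecMul_vecMul, hV', Matrix.vecMul_one]) },
        hm, finite_fixedVectors (h x₀), projective_fixedVectors (h x₀), ?_, ?_⟩
      · have hc' := hc.comp (continuous_subtype_val (p := fun z => z.proj ∈ U))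
        -- The vector `v W` already lies in the row space of `q(x₀)`, so inserting the projection
        -- changes nothing and yields continuity into the module topology.
        refine (hproj.comp (hc'.snd.matrix_vecMul (hW.comp hc'.fst))).congr fun z => ?_
        refine Subtype.ext ?_
        change (z.1.2.1 ᵥ* W z.1.proj) ᵥ* q x₀ = z.1.2.1 ᵥ* W z.1.proj
        rw [Matrix.vecMul_vecMul, ← hl, ← Matrix.vecMul_vecMul, z.1.2.2]
      · exact continuous_induced_rng.2 ((continuous_subtype_val.comp continuous_fst).prodMk
          ((hsub.comp continuous_snd).matrix_vecMul (hVc.comp continuous_fst))) }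

section OfIdem

variable {q : X → Matrix ι ι A} {hq : Continuous q} {h : ∀ x, q x * q x = q x}

theorem ofIdem_isEmbedding : IsEmbedding fun z : (ofIdem q hq h).Total =>
    ((z.proj, z.2.1) : X × (ι → A)) := by
  refine ⟨⟨rfl⟩, ?_⟩
  rintro ⟨x, v⟩ ⟨y, w⟩ hvw
  obtain rfl : x = y := congrArg Prod.fst hvw
  obtain rfl : v = w := Subtype.ext (congrArg Prod.snd hvw)
  rfl

theorem continuous_ofIdem {Z : Type w} [TopologicalSpace Z] {f : Z → (ofIdem q hq h).Total}
    (h₁ : Continuous fun z => (f z).proj) (h₂ : Continuous fun z => (f z).2.1) : Continuous f :=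
  ofIdem_isEmbedding.continuous_iff.2 (h₁.prodMk h₂)

end OfIdem

end ABundle

/-! ### The idempotent attached to a frame -/

namespace ABundle.Frame

variable {A : Type v} [Ring A] [TopologicalSpace A] {X : Type u} [TopologicalSpace X]
  {E : ABundle A X} {ι : Type} [Fintype ι] (S : E.Frame ι)

/-- The idempotent matrix of functions presenting a framed bundle. -/
def idem (x : X) : Matrix ι ι A := Matrix.of fun i j => S.coord x (S.sec i x) j

theorem continuous_coord_sec (i : ι) : Continuous fun x => S.coord x (S.sec i x) :=
  S.continuous_coord.comp (S.continuous_sec i)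

theorem continuous_idem : Continuous S.idem :=
  continuous_pi fun i => S.continuous_coord_sec i

theorem coord_sum (x : X) (v : ι → A) : S.coord x (∑ i, v i • S.sec i x) = v ᵥ* S.idem x := by
  ext j
  simp [idem, Matrix.vecMul, dotProduct]

theorem coord_vecMul_idem (x : X) (e : E.fiber x) : S.coord x e ᵥ* S.idem x = S.coord x e := by
  rw [← coord_sum, S.sum_coord]

theorem sum_vecMul_idem (x : X) (v : ι → A) :
    ∑ i, (v ᵥ* S.idem x) i • S.sec i x = ∑ i, v i • S.sec i x := by
  rw [← coord_sum, S.sum_coord]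

theorem idem_mul_idem (x : X) : S.idem x * S.idem x = S.idem x := by
  classical
  -- Row `i` is the coordinate vector of `sec i`, and the matrix fixes every coordinate vector.
  refine Matrix.ext_of_single_vecMul fun i => ?_
  rw [← Matrix.vecMul_vecMul, ← S.coord_sum x (Pi.single i 1), coord_vecMul_idem]

end ABundle.Frame

/-! ### Elementary properties of the involutions -/

namespace AlgInvolution

variable {A : Type v} [Ring A] [Algebra ℝ A] [TopologicalSpace A] (σ : AlgInvolution A)

theorem ringHom_ringHom (a : A) : σ.ringHom (σ.ringHom a) = a := σ.involutive' a

theorem ringHom_algebraMap (t : ℝ) : σ.ringHom (algebraMap ℝ A t) = algebraMap ℝ A t :=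
  σ.toAlgHom.commutes t

theorem map_vecMul {ι : Type} [Fintype ι] (v : ι → A) (M : Matrix ι ι A) :
    (fun j => σ.ringHom (v j)) ᵥ* M.map σ.ringHom = fun j => σ.ringHom ((v ᵥ* M) j) := by
  ext j
  exact (RingHom.map_vecMul σ.ringHom M v j).symm

end AlgInvolution

namespace RealBundle

variable {A : Type v} [Ring A] [Algebra ℝ A] [TopologicalSpace A] {X : Type u}
  [TopologicalSpace X] {σ : AlgInvolution A} {τ : SpaceInvolution X} (E : RealBundle σ τ)

theorem bar_bar (z : E.Total) : E.bar (E.bar z) = z := E.conj_conj z.1 z.2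

theorem conj_bijective (x : X) : Function.Bijective (E.conj x) := by
  refine ⟨fun e f h => ?_, fun f => ?_⟩
  · have : E.bar ⟨x, e⟩ = E.bar ⟨x, f⟩ := congrArg (TotalSpace.mk (τ x)) h
    simpa [bar_bar] using congrArg E.bar this
  · have key : ∀ w : E.Total, w.proj = x → ∃ e, E.bar ⟨x, e⟩ = E.bar w := by
      rintro ⟨y, e⟩ rfl
      exact ⟨e, rfl⟩
    obtain ⟨e, he⟩ := key (E.bar ⟨τ x, f⟩) (τ.involutive' x)
    rw [bar_bar] at he
    exact ⟨e, by simpa [bar] using he⟩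

/-- The inverse of the conjugation `E_x → E_{x̄}`, as a map `E_{x̄} → E_x`. -/
noncomputable def unconj (x : X) : E.fiber (τ x) →+ E.fiber x :=
  (AddEquiv.ofBijective (E.conj x) (E.conj_bijective x)).symm

theorem conj_unconj (x : X) (e : E.fiber (τ x)) : E.conj x (E.unconj x e) = e :=
  (AddEquiv.ofBijective (E.conj x) (E.conj_bijective x)).apply_symm_apply e

theorem unconj_conj (x : X) (e : E.fiber x) : E.unconj x (E.conj x e) = e :=
  (AddEquiv.ofBijective (E.conj x) (E.conj_bijective x)).symm_apply_apply e

theorem unconj_smul (x : X) (a : A) (e : E.fiber (τ x)) :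
    E.unconj x (a • e) = σ.ringHom a • E.unconj x e := by
  refine (E.conj_bijective x).1 ?_
  rw [conj_unconj, map_smulₛₗ, conj_unconj, σ.ringHom_ringHom]

/-- On the total space the involution is its own inverse. Stated there, the identity needs no
transport between fibres, and continuity of `unconj` reduces to continuity of the involution. -/
theorem mk_unconj (x : X) (e : E.fiber (τ x)) :
    (⟨x, E.unconj x e⟩ : E.Total) = E.bar ⟨τ x, e⟩ := by
  obtain ⟨f, rfl⟩ := (E.conj_bijective x).2 e
  rw [unconj_conj]
  exact (E.conj_conj x f).symm

theorem unconj_section (s : ∀ x, E.fiber x) (x : X) :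
    E.unconj (τ x) (s (τ (τ x))) = E.conj x (s x) := by
  have h : (⟨τ x, E.unconj (τ x) (s (τ (τ x)))⟩ : E.Total) = ⟨τ x, E.conj x (s x)⟩ := by
    rw [mk_unconj]
    exact congrArg (fun y => E.bar ⟨y, s y⟩) (τ.involutive' x)
  simpa using h

theorem continuous_unconj_section {s : ∀ x, E.fiber x}
    (hs : Continuous fun x => (⟨x, s x⟩ : E.Total)) :
    Continuous fun x => (⟨x, E.unconj x (s (τ x))⟩ : E.Total) :=
  (E.continuous_conj.comp (hs.comp τ.continuous')).congr fun x => (E.mk_unconj x (s (τ x))).symm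

end RealBundle

/-! ## Equivariant frames -/

/-- Compatibility of a frame of a Real bundle with the involutions. -/
structure ABundle.Frame.IsReal {A : Type v} [Ring A] [Algebra ℝ A] [TopologicalSpace A]
    {X : Type u} [TopologicalSpace X] {σ : AlgInvolution A} {τ : SpaceInvolution X}
    {E : RealBundle σ τ} {ι : Type} [Fintype ι] (S : E.toABundle.Frame ι) : Prop where
  conj_sec : ∀ i x, S.sec i (τ x) = E.conj x (S.sec i x)
  coord_conj : ∀ x e i, S.coord (τ x) (E.conj x e) i = σ.ringHom (S.coord x e i)

namespace RealBundle

variable {A : Type v} [Ring A] [Algebra ℝ A] [TopologicalSpace A] [IsTopologicalRing A]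
  {X : Type u} [TopologicalSpace X] {σ : AlgInvolution A} {τ : SpaceInvolution X}

/-- Doubling a frame with the help of a unit `u` with `ū = -u` makes it equivariant. -/
theorem exists_isReal_of_frame (hσ : σ.IsBalanced) (E : RealBundle σ τ) {n : ℕ}
    (S : E.toABundle.Frame (Fin n)) :
    ∃ S' : E.toABundle.Frame (Fin n ⊕ Fin n), S'.IsReal := by
  obtain ⟨a, ha⟩ := hσ
  have ha' : σ.ringHom (↑a⁻¹ : A) = -(↑a⁻¹ : A) := by
    have h1 : σ.ringHom (↑a⁻¹ : A) * (a : A) = -1 := by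
      have := congrArg (fun t => -t) ((map_mul σ.ringHom (↑a⁻¹ : A) (a : A)).symm.trans
        (by rw [Units.inv_mul, map_one]))
      simpa [ha] using this
    calc σ.ringHom (↑a⁻¹ : A) = σ.ringHom (↑a⁻¹ : A) * a * ↑a⁻¹ := by simp
      _ = -(↑a⁻¹ : A) := by rw [h1, neg_one_mul]
  -- One factor `2` comes from combining sums with differences, another from using two frames of `E`
  -- at once; `1/4` cancels both.
  let q : A := algebraMap ℝ A 4⁻¹
  have hq : σ.ringHom q = q := σ.ringHom_algebraMap _
  have hq' : ∀ b : A, b * q = q * b := fun b => (Algebra.commutes _ b).symm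
  -- The `t i` and the `d` below are the conjugates of the sections and coordinates of `S`; they
  -- form a second frame, exchanged with `S` by the involution.
  let t (i : Fin n) (x : X) : E.fiber x := E.unconj x (S.sec i (τ x))
  have ht : ∀ i, Continuous fun x => (⟨x, t i x⟩ : E.Total) := fun i =>
    E.continuous_unconj_section (S.continuous_sec i)
  have ht1 : ∀ i x, t i (τ x) = E.conj x (S.sec i x) := fun i x => E.unconj_section (S.sec i) x
  have ht2 : ∀ i x, S.sec i (τ x) = E.conj x (t i x) := fun i x => (E.conj_unconj x _).symm
  let d (x : X) (e : E.fiber x) (i : Fin n) : A := σ.ringHom (S.coord (τ x) (E.conj x e) i)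
  have hd : Continuous fun z : E.Total => d z.proj z.2 := continuous_pi fun i =>
    σ.continuous'.comp ((continuous_apply i).comp (S.continuous_coord.comp E.continuous_conj))
  have hd1 : ∀ x e i, d (τ x) (E.conj x e) i = σ.ringHom (S.coord x e i) := fun x e i => by
    change σ.ringHom (S.coord (τ (τ x)) (E.conj (τ x) (E.conj x e)) i) = _
    exact congrArg (fun z : E.Total => σ.ringHom (S.coord z.proj z.2 i)) (E.conj_conj x e)
  have hd2 : ∀ x e i, S.coord (τ x) (E.conj x e) i = σ.ringHom (d x e i) := fun x e i =>
    (σ.ringHom_ringHom _).symm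
  have hdt : ∀ x e, ∑ i, d x e i • t i x = e := fun x e => by
    have := congrArg (E.unconj x) (S.sum_coord (τ x) (E.conj x e))
    rw [unconj_conj, map_sum] at this
    simpa only [unconj_smul] using this
  let S' : E.toABundle.Frame (Fin n ⊕ Fin n) :=
    { sec := Sum.elim (fun i x => q • (S.sec i x + t i x))
        (fun i x => q • ((↑a⁻¹ : A) • (S.sec i x + -t i x)))
      coord := fun x =>
        { toFun := fun e => Sum.elim (fun i => S.coord x e i + d x e i)
            (fun i => (S.coord x e i - d x e i) * a)
          map_add' := fun e f => by
            ext (i | i)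
            · simp only [d, map_add, Sum.elim_inl, Pi.add_apply]
              abel
            · simp only [d, map_add, Sum.elim_inr, Pi.add_apply]
              noncomm_ring
          map_smul' := fun b e => by
            ext (i | i) <;> simp [d, σ.ringHom_ringHom] <;> noncomm_ring }
      continuous_sec := by
        rintro (i | i)
        · exact E.continuous_smul_section continuous_const
            (E.continuous_add_section (S.continuous_sec i) (ht i))
        · exact E.continuous_smul_section continuous_const
            (E.continuous_smul_section continuous_const
              (E.continuous_add_section (S.continuous_sec i) (E.continuous_neg_section (ht i))))
      continuous_coord := by
        refine continuous_pi ?_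
        rintro (i | i)
        · exact ((continuous_apply i).comp S.continuous_coord).add ((continuous_apply i).comp hd)
        · exact (((continuous_apply i).comp S.continuous_coord).sub
            ((continuous_apply i).comp hd)).mul continuous_const
      sum_coord := fun x e => by
        rw [Fintype.sum_sum_type, ← Finset.sum_add_distrib]
        -- This is `(c + d)(s + t) + (c - d)(s - t) = 2(cs + dt)`: the unit in the second coordinate
        -- cancels its inverse in the second section, and the cross terms drop out.
        have key : ∀ c d' : A, ∀ s t : E.fiber x, (c + d') • q • (s + t) +
            ((c - d') * a) • q • ((↑a⁻¹ : A) • (s + -t)) =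
            (q * 2) • (c • s + d' • t) := fun c d' s t => by
          have h1 : (c - d') * a * q * (↑a⁻¹ : A) = q * (c - d') := by
            rw [hq', mul_assoc q, mul_assoc (c - d'), Units.mul_inv, mul_one]
          rw [smul_smul, smul_smul, smul_smul, h1, hq', mul_smul, mul_smul, mul_smul, ← smul_add]
          congr 1
          rw [two_smul A]
          simp only [add_smul, sub_smul, smul_add, smul_neg]
          abel
        refine (Finset.sum_congr rfl fun i _ => key _ _ _ _).trans ?_
        rw [← Finset.smul_sum, Finset.sum_add_distrib, S.sum_coord, hdt, ← two_smul A, smul_smul]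
        have : q * 2 * 2 = 1 := by
          have h2 : (2 : A) = algebraMap ℝ A 2 := (map_ofNat (algebraMap ℝ A) 2).symm
          rw [h2, ← map_mul, ← map_mul]
          norm_num
        rw [this, one_smul] }
  refine ⟨S', ⟨?_, ?_⟩⟩
  · rintro (i | i) x
    · change q • (S.sec i (τ x) + t i (τ x)) = E.conj x (q • (S.sec i x + t i x))
      rw [map_smulₛₗ, map_add, hq, ht1, ht2, add_comm]
    · change q • (↑a⁻¹ : A) • (S.sec i (τ x) + -t i (τ x)) =
        E.conj x (q • (↑a⁻¹ : A) • (S.sec i x + -t i x))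
      rw [map_smulₛₗ, map_smulₛₗ, map_add, map_neg, hq, ha', ht1, ht2, neg_smul, ← smul_neg,
        neg_add, neg_neg, add_comm]
  · rintro x e (i | i)
    · change S.coord (τ x) (E.conj x e) i + d (τ x) (E.conj x e) i =
        σ.ringHom (S.coord x e i + d x e i)
      rw [hd1, hd2, map_add, add_comm]
    · change (S.coord (τ x) (E.conj x e) i - d (τ x) (E.conj x e) i) * a =
        σ.ringHom ((S.coord x e i - d x e i) * a)
      rw [hd1, hd2, map_mul, map_sub, ha]
      noncomm_ring

/-- Over a compact Hausdorff space every Real bundle has a finite equivariant frame. -/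
theorem exists_real_frame [ContinuousSMul ℝ A] [CompactSpace X] [T2Space X] (hσ : σ.IsBalanced)
    (E : RealBundle σ τ) : ∃ (n : ℕ) (S : E.toABundle.Frame (Fin n)), S.IsReal := by
  obtain ⟨n, ⟨S⟩⟩ := E.toABundle.exists_frame
  obtain ⟨S', h⟩ := E.exists_isReal_of_frame hσ S
  exact ⟨_, S'.reindex (Fintype.equivFin _).symm,
    ⟨fun i x => h.conj_sec _ x, fun x e i => h.coord_conj x e _⟩⟩

end RealBundle

namespace ABundle.Frame.IsReal

variable {A : Type v} [Ring A] [Algebra ℝ A] [TopologicalSpace A] {X : Type u}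
  [TopologicalSpace X] {σ : AlgInvolution A} {τ : SpaceInvolution X} {E : RealBundle σ τ}
  {ι : Type} [Fintype ι] {S : E.toABundle.Frame ι}

theorem idem_conj (hS : S.IsReal) (x : X) : S.idem (τ x) = (S.idem x).map σ.ringHom := by
  ext i j
  simp [ABundle.Frame.idem, hS.conj_sec, hS.coord_conj]

theorem conj_sum (hS : S.IsReal) (x : X) (v : ι → A) :
    E.conj x (∑ i, v i • S.sec i x) = ∑ i, σ.ringHom (v i) • S.sec i (τ x) := by
  simp [map_sum, hS.conj_sec, map_smulₛₗ]

end ABundle.Frame.IsReal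

/-! ## Real bundles of equivariant idempotents -/

namespace RealBundle

variable {A : Type v} [NormedRing A] [NormedAlgebra ℝ A] [CompleteSpace A] {X : Type u}
  [TopologicalSpace X] {σ : AlgInvolution A} {τ : SpaceInvolution X} {ι : Type} [Fintype ι]

/-- The Real bundle of row spaces of an equivariant family of idempotent matrices. -/
def ofIdem (q : X → Matrix ι ι A) (hq : Continuous q) (h : ∀ x, q x * q x = q x)
    (hc : ∀ x, q (τ x) = (q x).map σ.ringHom) : RealBundle σ τ where
  toABundle := ABundle.ofIdem q hq h
  conj x :=
    { toFun := fun v => ⟨fun i => σ.ringHom (v.1 i), by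
        rw [mem_fixedVectors, hc, σ.map_vecMul, v.2]⟩
      map_add' := fun v w => Subtype.ext (funext fun i => map_add σ.ringHom (v.1 i) (w.1 i))
      map_smul' := fun a v => Subtype.ext (funext fun i => map_mul σ.ringHom a (v.1 i)) }
  continuous_conj := ABundle.continuous_ofIdem
    (τ.continuous'.comp ABundle.ofIdem_isEmbedding.continuous.fst)
    (continuous_pi fun i => σ.continuous'.comp
      ((continuous_apply i).comp ABundle.ofIdem_isEmbedding.continuous.snd))
  conj_conj x e := ABundle.ofIdem_isEmbedding.injective
    (Prod.ext (τ.involutive' x) (funext fun i => σ.involutive' (e.1 i)))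

/-- A Real bundle with an equivariant frame is a direct summand of a trivial Real bundle. -/
theorem exists_complement (E : RealBundle σ τ) {n : ℕ} {S : E.toABundle.Frame (Fin n)}
    (hS : S.IsReal) : ∃ F : RealBundle σ τ, (E.sum F).Iso (RealBundle.trivial σ τ n) := by
  let p (x : X) : Matrix (Fin n) (Fin n) A := 1 - S.idem x
  have hp : Continuous p := continuous_const.sub S.continuous_idem
  have hpp : ∀ x, p x * p x = p x := fun x => by
    simp only [p, mul_sub, sub_mul, one_mul, mul_one, S.idem_mul_idem]
    abel
  have hpc : ∀ x, p (τ x) = (p x).map σ.ringHom := fun x => by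
    ext i j
    by_cases h : i = j <;> simp [p, hS.idem_conj, h]
  let F : RealBundle σ τ := ofIdem p hp hpp hpc
  -- Fixed by `1 - p` means killed by `p`, so the frame sends such a vector to zero in `E`.
  have hF : ∀ x (f : F.fiber x), f.1 ᵥ* S.idem x = 0 := fun x f => by
    have := f.2
    rw [mem_fixedVectors, Matrix.vecMul_sub, Matrix.vecMul_one] at this
    simpa using this
  have hF' : ∀ x (f : F.fiber x), ∑ i, f.1 i • S.sec i x = 0 := fun x f => by
    rw [← S.sum_vecMul_idem, hF]
    simp
  let Φ (x : X) : (E.sum F).fiber x ≃ₗ[A] (Fin n → A) :=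
    { toFun := fun e => S.coord x e.1 + e.2.1
      map_add' := fun e f => by
        change S.coord x (e.1 + f.1) + (e.2.1 + f.2.1) = _
        rw [map_add]
        abel
      map_smul' := fun a e => by
        change S.coord x (a • e.1) + a • e.2.1 = a • (S.coord x e.1 + e.2.1)
        rw [map_smul, smul_add]
      invFun := fun v => (∑ i, v i • S.sec i x, fixedProjection (hpp x) v)
      left_inv := fun e => by
        refine Prod.ext ?_ (Subtype.ext ?_)
        · change ∑ i, (S.coord x e.1 i + e.2.1 i) • S.sec i x = e.1
          simp only [add_smul, Finset.sum_add_distrib, S.sum_coord, hF', add_zero]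
        · change (S.coord x e.1 + e.2.1) ᵥ* p x = e.2.1
          have h : e.2.1 ᵥ* p x = e.2.1 := e.2.2
          rw [Matrix.add_vecMul, h]
          simp [p, Matrix.vecMul_sub, S.coord_vecMul_idem]
      right_inv := fun v => by
        change S.coord x (∑ i, v i • S.sec i x) + v ᵥ* p x = v
        rw [S.coord_sum, Matrix.vecMul_sub, Matrix.vecMul_one]
        abel }
  refine ⟨F, Φ, ?_, ?_, ?_⟩
  · have h := ABundle.sum_continuous E.toABundle F.toABundle
    refine continuous_induced_rng.2 (((E.sum F).continuous_proj).prodMk ?_)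
    exact (S.continuous_coord.comp h.1).add
      ((ABundle.ofIdem_isEmbedding (hq := hp) (h := hpp)).continuous.snd.comp h.2)
  · have h : Continuous fun z : (RealBundle.trivial σ τ n).Total =>
      ((z.proj, z.2) : X × (Fin n → A)) := continuous_induced_dom
    refine ABundle.continuous_sum ?_ ?_
    · exact ABundle.Frame.continuous_combination (a := fun i z => z.2 i) h.fst
        (fun i => (continuous_apply i).comp h.snd) S.continuous_sec
    · exact ABundle.continuous_ofIdem (hq := hp) (h := hpp) h.fst
        (h.snd.matrix_vecMul (hp.comp h.fst))
  · intro x e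
    refine funext fun i => ?_
    change S.coord (τ x) (E.conj x e.1) i + σ.ringHom (e.2.1 i) =
      σ.ringHom (S.coord x e.1 i + e.2.1 i)
    rw [hS.coord_conj, map_add]

end RealBundle

/-! ## Modules of equivariant sections -/

namespace RealBundle

section Sections

variable {A : Type v} [Ring A] [Algebra ℝ A] [TopologicalSpace A] [IsTopologicalRing A]
  {X : Type u} [TopologicalSpace X] {σ : AlgInvolution A} {τ : SpaceInvolution X}

/-- The group of continuous sections `s` with `s (x̄) = \overline{s x}`. -/
def sections (E : RealBundle σ τ) : AddSubgroup (∀ x, E.fiber x) where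
  carrier := {s | Continuous (fun x => (⟨x, s x⟩ : E.Total)) ∧ ∀ x, s (τ x) = E.conj x (s x)}
  add_mem' hs ht := ⟨E.continuous_add_section hs.1 ht.1, fun x => by
    simp [hs.2 x, ht.2 x]⟩
  zero_mem' := ⟨E.continuous_zero_section continuous_id, fun x => by simp⟩
  neg_mem' hs := ⟨E.continuous_neg_section hs.1, fun x => by simp [hs.2 x]⟩

instance (E : RealBundle σ τ) : Module (equivariantMaps σ τ) E.sections where
  smul f s := ⟨fun x => (f : C(X, A)) x • s.1 x,
    E.continuous_smul_section (f : C(X, A)).continuous s.2.1, fun x => by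
      beta_reduce
      rw [s.2.2 x, f.2 x, map_smulₛₗ]⟩
  one_smul s := Subtype.ext (funext fun x => one_smul A (s.1 x))
  mul_smul f g s := Subtype.ext (funext fun x =>
    mul_smul ((f : C(X, A)) x) ((g : C(X, A)) x) (s.1 x))
  smul_zero f := Subtype.ext (funext fun x => smul_zero ((f : C(X, A)) x))
  smul_add f s t := Subtype.ext (funext fun x => smul_add ((f : C(X, A)) x) (s.1 x) (t.1 x))
  add_smul f g s := Subtype.ext (funext fun x =>
    add_smul ((f : C(X, A)) x) ((g : C(X, A)) x) (s.1 x))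
  zero_smul s := Subtype.ext (funext fun x => zero_smul A (s.1 x))

theorem sum_smul_apply {E : RealBundle σ τ} {ι : Type} [Fintype ι] (f : ι → equivariantMaps σ τ)
    (s : ι → E.sections) (x : X) :
    (∑ i, f i • s i).1 x = ∑ i, (f i : C(X, A)) x • (s i).1 x := by
  rw [AddSubgroup.val_finsetSum, Finset.sum_apply]
  rfl

/-- Once the sections are a `Λ`-module in their own right, the relation can be handled by composing
linear equivalences. -/
theorem isRealSections_iff (P : FGProj (equivariantMaps σ τ)) (E : RealBundle σ τ) :
    IsRealSections P E ↔ Nonempty (P.carrier ≃ₗ[equivariantMaps σ τ] E.sections) := by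
  constructor
  · rintro ⟨j, hj, hsmul, hr⟩
    let f : P.carrier →ₗ[equivariantMaps σ τ] E.sections :=
      { toFun := fun p => ⟨j p, hr.subset ⟨p, rfl⟩⟩
        map_add' := fun p q => Subtype.ext (map_add j p q)
        map_smul' := fun a p => Subtype.ext (funext (hsmul a p)) }
    refine ⟨LinearEquiv.ofBijective f ⟨fun p q h => hj (congrArg Subtype.val h), fun s => ?_⟩⟩
    obtain ⟨p, hp⟩ := hr.superset s.2
    exact ⟨p, Subtype.ext hp⟩
  · rintro ⟨e⟩
    refine ⟨E.sections.subtype.comp e.toLinearMap.toAddMonoidHom,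
      Subtype.val_injective.comp e.injective, fun f p x => ?_, ?_⟩
    · change (e (f • p)).1 x = _
      rw [map_smul]
      rfl
    · ext s
      constructor
      · rintro ⟨p, rfl⟩
        exact (e p).2
      · intro hs
        exact ⟨e.symm ⟨s, hs⟩, congrArg Subtype.val (e.apply_symm_apply ⟨s, hs⟩)⟩

theorem sections_congr {E F : RealBundle σ τ} (h : E.Iso F) :
    Nonempty (E.sections ≃ₗ[equivariantMaps σ τ] F.sections) := by
  obtain ⟨Φ, h, h', hc⟩ := h
  have hc' : ∀ x f, (Φ (τ x)).symm (F.conj x f) = E.conj x ((Φ x).symm f) := fun x f => by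
    rw [LinearEquiv.symm_apply_eq, hc, LinearEquiv.apply_symm_apply]
  exact ⟨{
    toFun := fun s => ⟨fun x => Φ x (s.1 x), h.comp s.2.1, fun x => by
      beta_reduce
      rw [s.2.2, hc]⟩
    invFun := fun s => ⟨fun x => (Φ x).symm (s.1 x), h'.comp s.2.1, fun x => by
      beta_reduce
      rw [s.2.2, hc']⟩
    map_add' := fun s t => Subtype.ext (funext fun x => map_add (Φ x) (s.1 x) (t.1 x))
    map_smul' := fun f s => Subtype.ext (funext fun x =>
      map_smul (Φ x) ((f : C(X, A)) x) (s.1 x))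
    left_inv := fun s => Subtype.ext (funext fun x => (Φ x).symm_apply_apply _)
    right_inv := fun s => Subtype.ext (funext fun x => (Φ x).apply_symm_apply _) }⟩

/-- The equivariant sections of a Whitney sum. -/
def sectionsSum (E F : RealBundle σ τ) :
    (E.sum F).sections ≃ₗ[equivariantMaps σ τ] E.sections × F.sections where
  toFun s := (⟨fun x => (s.1 x).1, (ABundle.sum_continuous _ _).1.comp s.2.1, fun x =>
      congrArg Prod.fst (s.2.2 x)⟩,
    ⟨fun x => (s.1 x).2, (ABundle.sum_continuous _ _).2.comp s.2.1, fun x =>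
      congrArg Prod.snd (s.2.2 x)⟩)
  invFun s := ⟨fun x => (s.1.1 x, s.2.1 x), ABundle.continuous_sum s.1.2.1 s.2.2.1, fun x =>
    Prod.ext (s.1.2.2 x) (s.2.2.2 x)⟩
  map_add' _ _ := rfl
  map_smul' _ _ := rfl

end Sections

end RealBundle

/-! ### Section modules with an equivariant frame, and the bundle maps they induce -/

namespace ABundle.Frame

variable {A : Type v} [Ring A] [Algebra ℝ A] [TopologicalSpace A] [IsTopologicalRing A]
  {X : Type u} [TopologicalSpace X] {σ : AlgInvolution A} {τ : SpaceInvolution X}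
  {E F : RealBundle σ τ} {ι : Type} [Fintype ι] {S : E.toABundle.Frame ι}

/-- The sections of an equivariant frame. -/
def IsReal.sec (hS : S.IsReal) (i : ι) : E.sections :=
  ⟨S.sec i, S.continuous_sec i, hS.conj_sec i⟩

/-- The coordinates of an equivariant section with respect to an equivariant frame. -/
def IsReal.coord (hS : S.IsReal) :
    E.sections →ₗ[equivariantMaps σ τ] (ι → equivariantMaps σ τ) where
  toFun s i := ⟨⟨fun x => S.coord x (s.1 x) i,
    (continuous_apply i).comp (S.continuous_coord.comp s.2.1)⟩, fun x => by
      change S.coord (τ x) (s.1 (τ x)) i = _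
      rw [s.2.2, hS.coord_conj]
      rfl⟩
  map_add' s t := by
    ext i x
    exact congrFun (map_add (S.coord x) (s.1 x) (t.1 x)) i
  map_smul' f s := by
    ext i x
    exact congrFun (map_smul (S.coord x) ((f : C(X, A)) x) (s.1 x)) i

theorem IsReal.sum_coord (hS : S.IsReal) (s : E.sections) :
    ∑ i, hS.coord s i • hS.sec i = s := by
  refine Subtype.ext (funext fun x => ?_)
  rw [RealBundle.sum_smul_apply]
  exact S.sum_coord x (s.1 x)

/-- This splitting exhibits the section module as a retract of `Λⁿ`, which gives projectivity. -/
theorem IsReal.linearCombination_comp_coord (hS : S.IsReal) :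
    (Fintype.linearCombination (equivariantMaps σ τ) hS.sec).comp hS.coord = LinearMap.id :=
  LinearMap.ext hS.sum_coord

theorem IsReal.finite_sections (hS : S.IsReal) :
    Module.Finite (equivariantMaps σ τ) E.sections :=
  Module.Finite.of_surjective (Fintype.linearCombination (equivariantMaps σ τ) hS.sec)
    fun s => ⟨hS.coord s, hS.sum_coord s⟩

theorem IsReal.projective_sections (hS : S.IsReal) :
    Module.Projective (equivariantMaps σ τ) E.sections :=
  Module.Projective.of_split hS.coord _ hS.linearCombination_comp_coord

/-- The map of bundles induced by a map of modules of equivariant sections. -/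
def IsReal.extend (hS : S.IsReal) (ψ : E.sections →ₗ[equivariantMaps σ τ] F.sections) (x : X) :
    E.fiber x →ₗ[A] F.fiber x :=
  (Fintype.linearCombination A fun i => (ψ (hS.sec i)).1 x).comp (S.coord x)

theorem IsReal.extend_apply (hS : S.IsReal) (ψ : E.sections →ₗ[equivariantMaps σ τ] F.sections)
    (x : X) (e : E.fiber x) : hS.extend ψ x e = ∑ i, S.coord x e i • (ψ (hS.sec i)).1 x := rfl

/-- Expand `s` in the frame over `Λ` and use linearity of `ψ`. Thus the extension, although defined
through a frame, induces `ψ` on equivariant sections. -/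
theorem IsReal.extend_section (hS : S.IsReal)
    (ψ : E.sections →ₗ[equivariantMaps σ τ] F.sections) (s : E.sections) (x : X) :
    hS.extend ψ x (s.1 x) = (ψ s).1 x := by
  conv_rhs => rw [← hS.sum_coord s, map_sum]
  simp_rw [map_smul]
  rw [RealBundle.sum_smul_apply]
  rfl

theorem IsReal.continuous_extend (hS : S.IsReal)
    (ψ : E.sections →ₗ[equivariantMaps σ τ] F.sections) :
    Continuous (ABundle.totalMap E.toABundle F.toABundle fun x => hS.extend ψ x) :=
  continuous_combination (a := fun i (z : E.Total) => S.coord z.proj z.2 i) E.continuous_proj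
    (fun i => (continuous_apply i).comp S.continuous_coord) fun i => (ψ (hS.sec i)).2.1

theorem IsReal.extend_conj (hS : S.IsReal) (ψ : E.sections →ₗ[equivariantMaps σ τ] F.sections)
    (x : X) (e : E.fiber x) :
    hS.extend ψ (τ x) (E.conj x e) = F.conj x (hS.extend ψ x e) := by
  simp only [extend_apply, map_sum, map_smulₛₗ, hS.coord_conj, (ψ _).2.2]

/-- Real bundles with isomorphic modules of equivariant sections are isomorphic. -/
theorem IsReal.iso_of_sections (hS : S.IsReal) {κ : Type} [Fintype κ] {T : F.toABundle.Frame κ}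
    (hT : T.IsReal) (ψ : E.sections ≃ₗ[equivariantMaps σ τ] F.sections) : E.Iso F := by
  -- Equivariant sections span every fibre, so it suffices to check the composite on the frame,
  -- where it is `ψ.symm ∘ ψ`.
  have h1 : ∀ x e, hT.extend ψ.symm.toLinearMap x (hS.extend ψ.toLinearMap x e) = e := fun x e => by
    conv_rhs => rw [← S.sum_coord x e]
    rw [hS.extend_apply, map_sum]
    refine Finset.sum_congr rfl fun i _ => ?_
    rw [map_smul, hT.extend_section]
    exact congrArg (fun s : E.sections => _ • s.1 x) (ψ.symm_apply_apply (hS.sec i))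
  have h2 : ∀ x e, hS.extend ψ.toLinearMap x (hT.extend ψ.symm.toLinearMap x e) = e := fun x e => by
    conv_rhs => rw [← T.sum_coord x e]
    rw [hT.extend_apply, map_sum]
    refine Finset.sum_congr rfl fun i _ => ?_
    rw [map_smul, hS.extend_section]
    exact congrArg (fun s : F.sections => _ • s.1 x) (ψ.apply_symm_apply (hT.sec i))
  exact ⟨fun x => LinearEquiv.ofLinearMap (hS.extend ψ.toLinearMap x)
      (hT.extend ψ.symm.toLinearMap x) (LinearMap.ext (h2 x)) (LinearMap.ext (h1 x)),
    hS.continuous_extend _, hT.continuous_extend _, hS.extend_conj _⟩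

end ABundle.Frame

/-! ## Realization of projective modules -/

namespace RealBundle

variable {A : Type v} [NormedRing A] [NormedAlgebra ℝ A] [CompleteSpace A] {X : Type u}
  [TopologicalSpace X] {σ : AlgInvolution A} {τ : SpaceInvolution X}

/-- Every finitely generated projective module over the ring of equivariant functions is the
module of equivariant sections of a Real bundle. -/
theorem exists_isRealSections (P : FGProj (equivariantMaps σ τ)) :
    ∃ E : RealBundle σ τ, IsRealSections P E := by
  obtain ⟨n, f, g, -, hg, hfg⟩ :=
    Module.Finite.exists_comp_eq_id_of_projective (equivariantMaps σ τ) P.carrier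
  replace hfg : ∀ p, f (g p) = p := LinearMap.congr_fun hfg
  -- The matrix of the idempotent `g ∘ f` of `Λⁿ`, evaluated at `x`. Its entries lie in `Λ`, which
  -- is exactly continuity and equivariance of `q`.
  let q (x : X) : Matrix (Fin n) (Fin n) A :=
    Matrix.of fun i j => (g (f (Pi.single i 1)) j : C(X, A)) x
  let ev (v : Fin n → equivariantMaps σ τ) (x : X) : Fin n → A := fun j => (v j : C(X, A)) x
  have hev : ∀ v x, ev v x ᵥ* q x = ev (g (f v)) x := fun v x => by
    ext j
    have h1 : g (f v) = ∑ i, v i • g (f (Pi.single i 1)) := by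
      conv_lhs => rw [pi_eq_sum_univ' v]
      simp only [map_sum, map_smul]
    change ∑ i, ev v x i * q x i j = ((g (f v) j : equivariantMaps σ τ) : C(X, A)) x
    rw [h1, Finset.sum_apply, AddSubmonoidClass.coe_finsetSum, ContinuousMap.sum_apply]
    rfl
  have hq : Continuous q := continuous_pi fun i => continuous_pi fun j =>
    (g (f (Pi.single i 1)) j : C(X, A)).continuous
  have hrow : ∀ x i, q x i = ev (g (f (Pi.single i 1))) x := fun _ _ => rfl
  have hqq : ∀ x, q x * q x = q x := fun x => by
    ext i j
    change ((q x i) ᵥ* q x) j = _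
    rw [hrow, hev, hfg]
  have hqc : ∀ x, q (τ x) = (q x).map σ.ringHom := fun x => by
    ext i j
    exact (g (f (Pi.single i 1)) j).2 x
  refine ⟨ofIdem q hq hqq hqc, AddMonoidHom.mk' (fun p x => ⟨ev (g p) x, ?_⟩) ?_, ?_, ?_, ?_⟩
  · rw [mem_fixedVectors, hev, hfg]
  · intro p p'
    refine funext fun x => Subtype.ext (funext fun j => ?_)
    change (g (p + p') j : C(X, A)) x = (g p j : C(X, A)) x + (g p' j : C(X, A)) x
    rw [map_add]
    rfl
  · intro p p' h
    refine hg ?_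
    ext j x
    exact congrFun (congrArg Subtype.val (congrFun h x)) j
  · intro a p x
    refine Subtype.ext (funext fun j => ?_)
    change (g (a • p) j : C(X, A)) x = (a : C(X, A)) x * (g p j : C(X, A)) x
    rw [map_smul]
    rfl
  · ext s
    constructor
    · rintro ⟨p, rfl⟩
      exact ⟨ABundle.continuous_ofIdem (hq := hq) (h := hqq) continuous_id
          (continuous_pi fun j => (g p j : C(X, A)).continuous),
        fun x => Subtype.ext (funext fun j => (g p j).2 x)⟩
    · rintro ⟨hs, hc⟩
      have hs' : Continuous fun x => (s x).1 :=
        ((ABundle.ofIdem_isEmbedding (hq := hq) (h := hqq)).continuous.comp hs).snd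
      let v : Fin n → equivariantMaps σ τ := fun j =>
        ⟨⟨fun x => (s x).1 j, (continuous_apply j).comp hs'⟩, fun x =>
          congrFun (congrArg Subtype.val (hc x)) j⟩
      -- A section of the row spaces is a vector `v` over `Λ` fixed by `g ∘ f`, hence the image
      -- under `g` of `f v`.
      refine ⟨f v, funext fun x => Subtype.ext ?_⟩
      change ev (g (f v)) x = (s x).1
      rw [← hev]
      exact (s x).2

variable [CompactSpace X] [T2Space X]

/-- Equivariant sections identify `KR^A(X)` with `K₀(Λ)`. -/
theorem exists_equiv_K0 (hσ : σ.IsBalanced) : ∃ φ : KR σ τ ≃+ K0 (equivariantMaps σ τ),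
    ∀ E : RealBundle σ τ, ∃ P : FGProj (equivariantMaps σ τ),
      IsRealSections P E ∧ φ (KR.mk E) = K0.mk P := by
  refine exists_addEquiv_of_rel RealBundle.setoid (FGProj.setoid (equivariantMaps σ τ))
    RealBundle.sum (FGProj.sum _) (fun _ _ => rfl) (fun _ _ => rfl)
    (fun E P => IsRealSections P E) ?_ exists_isRealSections ?_ ?_
  · intro E
    obtain ⟨n, S, hS⟩ := E.exists_real_frame hσ
    have := hS.finite_sections
    have := hS.projective_sections
    exact ⟨⟨E.sections⟩, (isRealSections_iff _ _).2 ⟨.refl _ _⟩⟩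
  · intro E F P Q hP hQ
    obtain ⟨e⟩ := (isRealSections_iff _ _).1 hP
    obtain ⟨f⟩ := (isRealSections_iff _ _).1 hQ
    constructor
    · intro h
      obtain ⟨g⟩ := sections_congr h
      exact ⟨e.trans (g.trans f.symm)⟩
    · rintro ⟨g⟩
      obtain ⟨n, S, hS⟩ := E.exists_real_frame hσ
      obtain ⟨m, T, hT⟩ := F.exists_real_frame hσ
      exact hS.iso_of_sections hT (e.symm.trans (g.trans f))
  · intro E F P Q hP hQ
    obtain ⟨e⟩ := (isRealSections_iff _ _).1 hP
    obtain ⟨f⟩ := (isRealSections_iff _ _).1 hQ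
    exact (isRealSections_iff _ _).2 ⟨(LinearEquiv.prodCongr e f).trans (sectionsSum E F).symm⟩

end RealBundle

/-! ## Fixed bundles over a base with trivial involution -/

namespace AlgInvolution

variable {A : Type v} [Ring A] [Algebra ℝ A] [TopologicalSpace A] (σ : AlgInvolution A)

theorem ringHom_coe (a : σ.fixed) : σ.ringHom (a : A) = a := a.2

theorem coe_vecMul {ι : Type} [Fintype ι] (v : ι → σ.fixed) (M : Matrix ι ι σ.fixed) :
    (fun j => (v j : A)) ᵥ* M.map Subtype.val = fun j => ((v ᵥ* M) j : A) := by
  ext j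
  exact (RingHom.map_vecMul (σ.fixed.val : σ.fixed →+* A) M v j).symm

theorem isEmbedding_coe_pi (X : Type u) [TopologicalSpace X] (ι : Type) :
    IsEmbedding fun p : X × (ι → σ.fixed) => ((p.1, fun i => (p.2 i : A)) : X × (ι → A)) :=
  IsEmbedding.id.prodMap (IsEmbedding.piMap fun _ => IsEmbedding.subtypeVal)

/-- `A₀` is closed in `A` by continuity of the involution. Completeness is what allows idempotents
over `A₀` to define `A₀`-bundles. -/
theorem completeSpace_fixed {A : Type v} [NormedRing A] [NormedAlgebra ℝ A] [CompleteSpace A]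
    (σ : AlgInvolution A) : CompleteSpace σ.fixed :=
  IsClosed.completeSpace_coe (s := (σ.fixed : Set A))
    (hs := isClosed_eq σ.continuous' continuous_id)

end AlgInvolution

theorem ABundle.sum_isEmbedding {A : Type v} [Ring A] [TopologicalSpace A] {X : Type u}
    [TopologicalSpace X] (E F : ABundle A X) : IsEmbedding fun z : (E.sum F).Total =>
      ((⟨z.proj, z.2.1⟩ : E.Total), (⟨z.proj, z.2.2⟩ : F.Total)) := by
  refine ⟨⟨rfl⟩, ?_⟩
  rintro ⟨x, e, f⟩ ⟨y, e', f'⟩ h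
  obtain rfl : x = y := congrArg (fun p => p.1.proj) h
  obtain ⟨h₁, h₂⟩ := Prod.ext_iff.1 h
  obtain rfl : e = e' := by simpa using h₁
  obtain rfl : f = f' := by simpa using h₂
  rfl

section Fixed

variable {A : Type v} [Ring A] [Algebra ℝ A] [TopologicalSpace A] {X : Type u}
  [TopologicalSpace X] {σ : AlgInvolution A} {τ : SpaceInvolution X}

/-- An identification of an `A₀`-bundle with the fixed points of a Real bundle. -/
structure FixedInclusion (F : ABundle σ.fixed X) (E : RealBundle σ τ) where
  map : ∀ x, F.fiber x →+ E.fiber x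
  map_smul : ∀ (a : σ.fixed) (x : X) (e : F.fiber x), map x (a • e) = (a : A) • map x e
  isEmbedding : IsEmbedding fun z : F.Total => (⟨z.proj, map z.proj z.2⟩ : E.Total)
  range_eq : Set.range (fun z : F.Total => (⟨z.proj, map z.proj z.2⟩ : E.Total)) =
    {z | E.bar z = z}

theorem isFixedBundle_iff (F : ABundle σ.fixed X) (E : RealBundle σ τ) :
    IsFixedBundle F E ↔ Nonempty (FixedInclusion F E) :=
  ⟨fun ⟨j, h₁, h₂, h₃⟩ => ⟨⟨j, h₁, h₂, h₃⟩⟩, fun ⟨⟨j, h₁, h₂, h₃⟩⟩ => ⟨j, h₁, h₂, h₃⟩⟩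

/-- With `τ x = x` known only propositionally, `s x` and its conjugate lie in different fibre types,
so being fixed is expressed in the total space. The next lemma is the converse passage. -/
theorem RealBundle.bar_section (hτ : ∀ x, τ x = x) (E : RealBundle σ τ) {s : ∀ x, E.fiber x}
    (hs : ∀ x, s (τ x) = E.conj x (s x)) (x : X) : E.bar ⟨x, s x⟩ = ⟨x, s x⟩ := by
  change (⟨τ x, E.conj x (s x)⟩ : E.Total) = _
  rw [← hs]
  exact congrArg (fun y => (⟨y, s y⟩ : E.Total)) (hτ x)

theorem RealBundle.conj_section (hτ : ∀ x, τ x = x) (E : RealBundle σ τ) {s : ∀ x, E.fiber x}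
    (hs : ∀ x, E.bar ⟨x, s x⟩ = ⟨x, s x⟩) (x : X) : s (τ x) = E.conj x (s x) := by
  have h : (⟨τ x, s (τ x)⟩ : E.Total) = ⟨τ x, E.conj x (s x)⟩ :=
    (congrArg (fun y => (⟨y, s y⟩ : E.Total)) (hτ x)).trans (hs x).symm
  simpa using h

theorem RealBundle.bar_map {E E' : RealBundle σ τ} (Φ : ∀ x, E.fiber x → E'.fiber x)
    (hΦ : ∀ x e, Φ (τ x) (E.conj x e) = E'.conj x (Φ x e)) (z : E.Total) :
    E'.bar (ABundle.totalMap E.toABundle E'.toABundle Φ z) =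
      ABundle.totalMap E.toABundle E'.toABundle Φ (E.bar z) :=
  congrArg (TotalSpace.mk (τ z.proj)) (hΦ z.proj z.2).symm

namespace FixedInclusion

variable {F F' : ABundle σ.fixed X} {E E' : RealBundle σ τ} (J : FixedInclusion F E)
  (J' : FixedInclusion F' E')

theorem map_injective (x : X) : Function.Injective (J.map x) := fun e f h => by
  have : (⟨x, e⟩ : F.Total) = ⟨x, f⟩ :=
    J.isEmbedding.injective (congrArg (TotalSpace.mk x) h)
  simpa using this

theorem bar_map (x : X) (f : F.fiber x) : E.bar ⟨x, J.map x f⟩ = ⟨x, J.map x f⟩ :=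
  J.range_eq.subset ⟨⟨x, f⟩, rfl⟩

theorem exists_map_eq {x : X} {e : E.fiber x} (h : E.bar ⟨x, e⟩ = ⟨x, e⟩) :
    ∃ f, J.map x f = e := by
  obtain ⟨⟨y, f⟩, hf⟩ := J.range_eq.superset h
  obtain rfl : y = x := congrArg TotalSpace.proj hf
  exact ⟨f, by simpa using hf⟩

/-- Maps into the fixed points of a Real bundle factor through the fixed bundle. -/
theorem exists_lift (h : ∀ x, F.fiber x →+ E'.fiber x)
    (hsmul : ∀ (a : σ.fixed) (x : X) (f : F.fiber x), h x (a • f) = (a : A) • h x f)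
    (hc : Continuous fun z : F.Total => (⟨z.proj, h z.proj z.2⟩ : E'.Total))
    (hbar : ∀ x f, E'.bar ⟨x, h x f⟩ = ⟨x, h x f⟩) :
    ∃ g : ∀ x, F.fiber x →ₗ[σ.fixed] F'.fiber x,
      Continuous (ABundle.totalMap F F' fun x => g x) ∧ ∀ x f, J'.map x (g x f) = h x f := by
  -- Injectivity of the inclusion makes the chosen preimages additive and `A₀`-linear; its being an
  -- embedding makes them continuous.
  choose g hg using fun x f => J'.exists_map_eq (hbar x f)
  refine ⟨fun x => ⟨⟨g x, fun f f' => J'.map_injective x ?_⟩,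
    fun a f => J'.map_injective x ?_⟩, ?_, hg⟩
  · rw [map_add, hg, hg, hg, map_add]
  · rw [J'.map_smul, hg, hg]
    exact hsmul a x f
  · refine J'.isEmbedding.continuous_iff.2 (hc.congr fun z => ?_)
    exact congrArg (TotalSpace.mk z.proj) (hg z.proj z.2).symm

/-- Isomorphic Real bundles have isomorphic fixed bundles. -/
theorem iso_of_iso (J : FixedInclusion F E) (J' : FixedInclusion F' E') (h : E.Iso E') :
    F.Iso F' := by
  obtain ⟨Φ, hΦ, hΦ', hc⟩ := h
  have hc' : ∀ x f, (Φ (τ x)).symm (E'.conj x f) = E.conj x ((Φ x).symm f) := fun x f => by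
    rw [LinearEquiv.symm_apply_eq, hc, LinearEquiv.apply_symm_apply]
  obtain ⟨g, hg, hgJ⟩ := J'.exists_lift (F := F)
    (fun x => (Φ x : E.fiber x →+ E'.fiber x).comp (J.map x))
    (fun a x f => by
      change Φ x (J.map x (a • f)) = (a : A) • Φ x (J.map x f)
      rw [J.map_smul, _root_.map_smul])
    (hΦ.comp J.isEmbedding.continuous)
    (fun x f => (RealBundle.bar_map (fun x => Φ x) hc ⟨x, J.map x f⟩).trans
      (congrArg _ (J.bar_map x f)))
  obtain ⟨g', hg', hgJ'⟩ := J.exists_lift (F := F')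
    (fun x => ((Φ x).symm : E'.fiber x →+ E.fiber x).comp (J'.map x))
    (fun a x f => by
      change (Φ x).symm (J'.map x (a • f)) = (a : A) • (Φ x).symm (J'.map x f)
      rw [J'.map_smul, _root_.map_smul])
    (hΦ'.comp J'.isEmbedding.continuous)
    (fun x f => (RealBundle.bar_map (fun x => (Φ x).symm) hc' ⟨x, J'.map x f⟩).trans
      (congrArg _ (J'.bar_map x f)))
  replace hgJ : ∀ x f, J'.map x (g x f) = Φ x (J.map x f) := hgJ
  replace hgJ' : ∀ x f, J.map x (g' x f) = (Φ x).symm (J'.map x f) := hgJ'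
  refine ⟨fun x => LinearEquiv.ofLinearMap (g x) (g' x) (LinearMap.ext fun f => ?_)
    (LinearMap.ext fun f => ?_), hg, hg'⟩
  · refine J'.map_injective x ?_
    rw [LinearMap.comp_apply, hgJ, hgJ', LinearEquiv.apply_symm_apply]
    rfl
  · refine J.map_injective x ?_
    rw [LinearMap.comp_apply, hgJ', hgJ, LinearEquiv.symm_apply_apply]
    rfl

/-- Fixed bundles are compatible with Whitney sums. -/
def sum : FixedInclusion (F.sum F') (E.sum E') where
  map x := (J.map x).prodMap (J'.map x)
  map_smul a x e := Prod.ext (J.map_smul a x e.1) (J'.map_smul a x e.2)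
  isEmbedding := by
    refine ⟨(ABundle.sum_isEmbedding E.toABundle E'.toABundle).isInducing.of_comp_iff.1 ?_, ?_⟩
    · exact (J.isEmbedding.prodMap J'.isEmbedding).isInducing.comp
        (ABundle.sum_isEmbedding F F').isInducing
    · refine Function.Injective.of_comp (f := fun z : (E.sum E').Total =>
        ((⟨z.proj, z.2.1⟩ : E.Total), (⟨z.proj, z.2.2⟩ : E'.Total))) ?_
      exact (J.isEmbedding.prodMap J'.isEmbedding).injective.comp
        (ABundle.sum_isEmbedding F F').injective
  range_eq := by
    ext ⟨x, e, e'⟩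
    constructor
    · rintro ⟨⟨y, f, f'⟩, h⟩
      rw [← h]
      exact (ABundle.sum_isEmbedding E.toABundle E'.toABundle).injective
        (Prod.ext (J.bar_map y f) (J'.bar_map y f'))
    · intro h
      obtain ⟨f, rfl⟩ := J.exists_map_eq (x := x) (e := e)
        (congrArg (fun z : (E.sum E').Total => (⟨z.proj, z.2.1⟩ : E.Total)) h)
      obtain ⟨f', rfl⟩ := J'.exists_map_eq (x := x) (e := e')
        (congrArg (fun z : (E.sum E').Total => (⟨z.proj, z.2.2⟩ : E'.Total)) h)
      exact ⟨⟨x, f, f'⟩, rfl⟩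

variable [IsTopologicalRing A]

/-- An isomorphism of fixed bundles induces one of modules of equivariant sections. -/
theorem sections_equiv (J : FixedInclusion F E) (J' : FixedInclusion F' E')
    (hτ : ∀ x, τ x = x) (h : F.Iso F') :
    Nonempty (E.sections ≃ₗ[equivariantMaps σ τ] E'.sections) := by
  obtain ⟨Φ, hΦ, hΦ'⟩ := h
  -- An equivariant section takes values in the fixed points, hence is a section of `F`; it can be
  -- moved along `Φ` and included into `E'`.
  choose r hr using fun (s : E.sections) x =>
    J.exists_map_eq (E.bar_section hτ s.2.2 x)
  choose r' hr' using fun (s : E'.sections) x =>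
    J'.exists_map_eq (E'.bar_section hτ s.2.2 x)
  have hrc : ∀ s, Continuous fun x => (⟨x, r s x⟩ : F.Total) := fun s =>
    J.isEmbedding.continuous_iff.2 (s.2.1.congr fun x =>
      congrArg (TotalSpace.mk x) (hr s x).symm)
  have hrc' : ∀ s, Continuous fun x => (⟨x, r' s x⟩ : F'.Total) := fun s =>
    J'.isEmbedding.continuous_iff.2 (s.2.1.congr fun x =>
      congrArg (TotalSpace.mk x) (hr' s x).symm)
  let ψ (s : E.sections) : E'.sections := ⟨fun x => J'.map x (Φ x (r s x)),
    J'.isEmbedding.continuous.comp (hΦ.comp (hrc s)),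
    E'.conj_section hτ fun x => J'.bar_map x (Φ x (r s x))⟩
  let ψ' (s : E'.sections) : E.sections := ⟨fun x => J.map x ((Φ x).symm (r' s x)),
    J.isEmbedding.continuous.comp (hΦ'.comp (hrc' s)),
    E.conj_section hτ fun x => J.bar_map x ((Φ x).symm (r' s x))⟩
  have h1 : ∀ s x, r' (ψ s) x = Φ x (r s x) := fun s x => J'.map_injective x (hr' (ψ s) x)
  have h2 : ∀ s x, r (ψ' s) x = (Φ x).symm (r' s x) := fun s x =>
    J.map_injective x (hr (ψ' s) x)
  refine ⟨{ toFun := ψ, invFun := ψ', map_add' := fun s t => ?_, map_smul' := fun f s => ?_,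
            left_inv := fun s => ?_, right_inv := fun s => ?_ }⟩
  · refine Subtype.ext (funext fun x => ?_)
    have : r (s + t) x = r s x + r t x := J.map_injective x (by
      rw [map_add, hr, hr, hr]
      rfl)
    change J'.map x (Φ x (r (s + t) x)) = J'.map x (Φ x (r s x)) + J'.map x (Φ x (r t x))
    rw [this, map_add, map_add]
  · refine Subtype.ext (funext fun x => ?_)
    -- Over a trivial involution the elements of `Λ` are `A₀`-valued, so `A₀`-linearity of `Φ`
    -- suffices for `Λ`-linearity.
    let a : σ.fixed := ⟨(f : C(X, A)) x, by
      have := f.2 x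
      rw [hτ] at this
      exact this.symm⟩
    have : r (f • s) x = a • r s x := J.map_injective x (by
      rw [J.map_smul, hr, hr]
      rfl)
    change J'.map x (Φ x (r (f • s) x)) = (a : A) • J'.map x (Φ x (r s x))
    rw [this, _root_.map_smul, J'.map_smul]
  · refine Subtype.ext (funext fun x => ?_)
    change J.map x ((Φ x).symm (r' (ψ s) x)) = s.1 x
    rw [h1, LinearEquiv.symm_apply_apply, hr]
  · refine Subtype.ext (funext fun x => ?_)
    change J'.map x (Φ x (r (ψ' s) x)) = s.1 x
    rw [h2, LinearEquiv.apply_symm_apply, hr']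

end FixedInclusion

/-- Equivariance compares the coordinates of `e` with those of its conjugate, here the same point of
the total space. Fixed vectors therefore have coordinates in `A₀`. -/
theorem ABundle.Frame.IsReal.coord_fixed {E : RealBundle σ τ} {ι : Type} [Fintype ι]
    {S : E.toABundle.Frame ι} (hS : S.IsReal) {x : X} {e : E.fiber x}
    (h : E.bar ⟨x, e⟩ = ⟨x, e⟩) (i : ι) : σ.ringHom (S.coord x e i) = S.coord x e i := by
  rw [← hS.coord_conj]
  exact congrArg (fun z : E.Total => S.coord z.proj z.2 i) h

end Fixed

/-! ### Passing between idempotents over `A` and over `A₀` -/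

section Banach

variable {A : Type v} [NormedRing A] [NormedAlgebra ℝ A] [CompleteSpace A] {X : Type u}
  [TopologicalSpace X] {σ : AlgInvolution A} {τ : SpaceInvolution X}

/-- The fixed points of a Real bundle with an equivariant frame form an `A₀`-bundle. -/
theorem exists_fixedInclusion (hτ : ∀ x, τ x = x) (E : RealBundle σ τ) {n : ℕ}
    {S : E.toABundle.Frame (Fin n)} (hS : S.IsReal) :
    ∃ F : ABundle σ.fixed X, Nonempty (FixedInclusion F E) := by
  have := σ.completeSpace_fixed
  -- The sections of the frame are themselves fixed, so the idempotent of the frame is already a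
  -- matrix over `A₀`.
  let q (x : X) : Matrix (Fin n) (Fin n) σ.fixed := Matrix.of fun i j =>
    ⟨S.idem x i j, hS.coord_fixed (E.bar_section hτ (hS.conj_sec i) x) j⟩
  have hqS : ∀ x, (q x).map Subtype.val = S.idem x := fun _ => rfl
  have hq : Continuous q := continuous_pi fun i => continuous_pi fun j =>
    ((continuous_apply j).comp (S.continuous_coord_sec i)).subtype_mk _
  have hqq : ∀ x, q x * q x = q x := fun x => by
    ext i j
    have h1 : (S.idem x i) ᵥ* S.idem x = S.idem x i :=
      congrFun (S.idem_mul_idem x) i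
    have h2 := σ.coe_vecMul (q x i) (q x)
    exact (congrFun h2 j).symm.trans (congrFun h1 j)
  let F := ABundle.ofIdem q hq hqq
  have hF : ∀ x (v : F.fiber x),
      S.coord x (∑ i, (v.1 i : A) • S.sec i x) = fun i => (v.1 i : A) := fun x v => by
    have := v.2
    rw [mem_fixedVectors] at this
    rw [S.coord_sum, ← hqS, σ.coe_vecMul, this]
  refine ⟨F, ⟨{
    map := fun x => AddMonoidHom.mk' (fun v => ∑ i, (v.1 i : A) • S.sec i x) fun v w => by
      rw [← Finset.sum_add_distrib]
      exact Finset.sum_congr rfl fun i _ => add_smul (v.1 i : A) (w.1 i : A) (S.sec i x)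
    map_smul := fun a x v => by
      change ∑ i, ((a : A) * (v.1 i : A)) • S.sec i x = (a : A) • ∑ i, (v.1 i : A) • S.sec i x
      simp only [Finset.smul_sum, mul_smul]
    isEmbedding := ?_
    range_eq := ?_ }⟩⟩
  · have he := ABundle.ofIdem_isEmbedding (hq := hq) (h := hqq)
    -- Following the inclusion with the coordinates of `E` gives the embedding of the row spaces
    -- into `X × A₀ⁿ`, then into `X × Aⁿ`; the first factor is thus an embedding.
    refine IsEmbedding.of_comp
      (g := fun z : E.Total => ((z.proj, S.coord z.proj z.2) : X × (Fin n → A))) ?_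
      (E.continuous_proj.prodMk S.continuous_coord) ?_
    · exact ABundle.Frame.continuous_combination (E := E.toABundle)
        (a := fun i (z : F.Total) => (z.2.1 i : A)) he.continuous.fst
        (fun i => continuous_subtype_val.comp ((continuous_apply i).comp he.continuous.snd))
        S.continuous_sec
    · have h : ((fun z : E.Total => ((z.proj, S.coord z.proj z.2) : X × (Fin n → A))) ∘
          fun z : F.Total => (⟨z.proj, ∑ i, (z.2.1 i : A) • S.sec i z.proj⟩ : E.Total)) =
          (fun p : X × (Fin n → σ.fixed) => ((p.1, fun i => (p.2 i : A)) : X × (Fin n → A))) ∘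
            fun z : F.Total => ((z.proj, z.2.1) : X × (Fin n → σ.fixed)) :=
        funext fun z => Prod.ext rfl (hF z.proj z.2)
      exact h ▸ (σ.isEmbedding_coe_pi X (Fin n)).comp he
  · ext ⟨x, e⟩
    constructor
    · rintro ⟨⟨y, v⟩, h⟩
      rw [← h]
      refine E.bar_section hτ (s := fun y => ∑ i, (v.1 i : A) • S.sec i y) (fun x => ?_) y
      rw [hS.conj_sum]
      simp only [σ.ringHom_coe]
    · intro h
      let v : Fin n → σ.fixed := fun i => ⟨S.coord x e i, hS.coord_fixed h i⟩
      have hv : v ᵥ* q x = v := by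
        ext j
        exact (congrFun (σ.coe_vecMul v (q x)) j).symm.trans
          (congrFun (S.coord_vecMul_idem x e) j)
      exact ⟨⟨x, ⟨v, hv⟩⟩, congrArg (TotalSpace.mk x) (S.sum_coord x e)⟩

/-- Every framed `A₀`-bundle consists of the fixed points of a Real bundle. -/
theorem exists_fixedInclusion_of_frame (hτ : ∀ x, τ x = x) (F : ABundle σ.fixed X) {n : ℕ}
    (S : F.Frame (Fin n)) : ∃ E : RealBundle σ τ, Nonempty (FixedInclusion F E) := by
  -- Extension of scalars from `A₀` to `A`, carried out on the presenting idempotent. Its entries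
  -- are fixed by the involution, so it is equivariant.
  let q (x : X) : Matrix (Fin n) (Fin n) A := (S.idem x).map Subtype.val
  have hq : Continuous q := S.continuous_idem.matrix_map continuous_subtype_val
  have hqq : ∀ x, q x * q x = q x := fun x => by
    ext i j
    have h1 : (S.idem x i) ᵥ* S.idem x = S.idem x i := congrFun (S.idem_mul_idem x) i
    have h2 := σ.coe_vecMul (S.idem x i) (S.idem x)
    rw [h1] at h2
    exact congrFun h2 j
  have hqc : ∀ x, q (τ x) = (q x).map σ.ringHom := fun x => by
    rw [hτ]
    ext i j
    exact (σ.ringHom_coe _).symm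
  let E : RealBundle σ τ := RealBundle.ofIdem q hq hqq hqc
  have he := ABundle.ofIdem_isEmbedding (hq := hq) (h := hqq)
  refine ⟨E, ⟨{
    map := fun x => AddMonoidHom.mk' (fun e => ⟨fun i => (S.coord x e i : A), by
        rw [mem_fixedVectors, σ.coe_vecMul, S.coord_vecMul_idem]⟩) fun e f => by
      refine Subtype.ext (funext fun i => ?_)
      exact congrArg Subtype.val (congrFun (map_add (S.coord x) e f) i)
    map_smul := fun a x e => Subtype.ext (funext fun i =>
      congrArg Subtype.val (congrFun (map_smul (S.coord x) a e) i))
    isEmbedding := ?_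
    range_eq := ?_ }⟩⟩
  · have hS : IsEmbedding fun z : F.Total =>
        ((z.proj, S.coord z.proj z.2) : X × (Fin n → σ.fixed)) := by
      -- The coordinates have the continuous left inverse `v ↦ ∑ v_i s_i`, so a framed bundle embeds
      -- in `X × A₀ⁿ`.
      refine Function.LeftInverse.isEmbedding (f := fun p : X × (Fin n → σ.fixed) =>
        (⟨p.1, ∑ i, p.2 i • S.sec i p.1⟩ : F.Total)) (fun z => ?_) ?_
        (F.continuous_proj.prodMk S.continuous_coord)
      · exact congrArg (TotalSpace.mk z.proj) (S.sum_coord z.proj z.2)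
      · exact ABundle.Frame.continuous_combination
          (a := fun i (p : X × (Fin n → σ.fixed)) => p.2 i) continuous_fst
          (fun i => (continuous_apply i).comp continuous_snd) S.continuous_sec
    have h := (σ.isEmbedding_coe_pi X (Fin n)).comp hS
    exact IsEmbedding.of_comp (he.continuous_iff.2 h.continuous) he.continuous h
  · ext ⟨x, e⟩
    constructor
    · rintro ⟨⟨y, f⟩, h⟩
      rw [← h]
      exact he.injective (Prod.ext (hτ y) (funext fun i => σ.ringHom_coe _))
    · intro h
      have h' : (fun i => σ.ringHom (e.1 i)) = e.1 :=
        congrArg (fun z : E.Total => z.2.1) h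
      let v : Fin n → σ.fixed := fun i => ⟨e.1 i, congrFun h' i⟩
      have hv : v ᵥ* S.idem x = v := by
        ext j
        exact (congrFun (σ.coe_vecMul v (S.idem x)) j).symm.trans (congrFun e.2 j)
      -- A fixed vector of the row space has entries in `A₀` and is fixed by the idempotent of `F`,
      -- so it is the coordinate vector of this combination.
      refine ⟨⟨x, ∑ i, v i • S.sec i x⟩, he.injective (Prod.ext rfl ?_)⟩
      change (fun i => (S.coord x (∑ i, v i • S.sec i x) i : A)) = e.1
      rw [S.coord_sum, hv]

/-- Over a base with trivial involution, passing to fixed points identifies `KR^A(X)` with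
`K^{A₀}(X)`. -/
theorem exists_equiv_KA [CompactSpace X] [T2Space X] (hσ : σ.IsBalanced) (hτ : ∀ x, τ x = x) :
    ∃ φ : KR σ τ ≃+ KA σ.fixed X, ∀ E : RealBundle σ τ, ∃ F : ABundle σ.fixed X,
      IsFixedBundle F E ∧ φ (KR.mk E) = KA.mk F := by
  refine exists_addEquiv_of_rel RealBundle.setoid ABundle.setoid RealBundle.sum ABundle.sum
    (fun _ _ => rfl) (fun _ _ => rfl) (fun E F => IsFixedBundle F E) ?_ ?_ ?_ ?_
  · intro E
    obtain ⟨n, S, hS⟩ := E.exists_real_frame hσ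
    obtain ⟨F, hF⟩ := exists_fixedInclusion hτ E hS
    exact ⟨F, (isFixedBundle_iff F E).2 hF⟩
  · intro F
    obtain ⟨n, ⟨S⟩⟩ := F.exists_frame
    obtain ⟨E, hE⟩ := exists_fixedInclusion_of_frame hτ F S
    exact ⟨E, (isFixedBundle_iff F E).2 hE⟩
  · intro E E' F F' hF hF'
    obtain ⟨J⟩ := (isFixedBundle_iff F E).1 hF
    obtain ⟨J'⟩ := (isFixedBundle_iff F' E').1 hF'
    refine ⟨J.iso_of_iso J', fun h => ?_⟩
    -- The isomorphism is recovered through section modules, which avoids extending scalars along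
    -- `A₀ → A`.
    obtain ⟨ψ⟩ := J.sections_equiv J' hτ h
    obtain ⟨n, S, hS⟩ := E.exists_real_frame hσ
    obtain ⟨m, T, hT⟩ := E'.exists_real_frame hσ
    exact hS.iso_of_sections hT ψ
  · intro E E' F F' hF hF'
    obtain ⟨J⟩ := (isFixedBundle_iff F E).1 hF
    obtain ⟨J'⟩ := (isFixedBundle_iff F' E').1 hF'
    exact (isFixedBundle_iff _ _).2 ⟨J.sum J'⟩

end Banach

end RealK

theorem mainTheorem4 {A : Type v} [NormedRing A] [NormedAlgebra ℝ A] [CompleteSpace A]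
    (σ : RealK.AlgInvolution A) (hσ : σ.IsBalanced)
    {X : Type u} [TopologicalSpace X] [CompactSpace X] [T2Space X]
    (τ : RealK.SpaceInvolution X) :
    (∀ E : RealK.RealBundle σ τ, ∃ (n : ℕ) (F : RealK.RealBundle σ τ),
      (E.sum F).Iso (RealK.RealBundle.trivial σ τ n)) ∧
    (∃ φ : RealK.KR σ τ ≃+ RealK.K0 (RealK.equivariantMaps σ τ),
      ∀ E : RealK.RealBundle σ τ, ∃ P : RealK.FGProj (RealK.equivariantMaps σ τ),
        RealK.IsRealSections P E ∧ φ (RealK.KR.mk E) = RealK.K0.mk P) ∧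
    ((∀ x, τ x = x) →
      ∃ φ : RealK.KR σ τ ≃+ RealK.KA σ.fixed X,
        ∀ E : RealK.RealBundle σ τ, ∃ F : RealK.ABundle σ.fixed X,
          RealK.IsFixedBundle F E ∧ φ (RealK.KR.mk E) = RealK.KA.mk F) := by
  refine ⟨fun E => ?_, RealK.RealBundle.exists_equiv_K0 hσ, RealK.exists_equiv_KA hσ⟩
  obtain ⟨n, S, hS⟩ := E.exists_real_frame hσ
  exact ⟨n, E.exists_complement hS⟩
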